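/- Let $b\in(-1,1)$, $m\in\mathbb N$, $m\ge 1$, and for $p\in(0,1)$, $z\in[0,1]$ put $$T_p(x)=\cos(p\arccos x),\qquad R(z)=\frac{(1+b)z^m-2b}{2-(1+b)z^m},\qquad \mathcal Q_p(z)=\left(\frac{2\,(b+T_p(R(z)))}{(1+b)\,(1+T_p(R(z)))}\right)^{1/m}.$$ Let $X$ be a non-negative integer-valued random variable that is not almost surely $0$, with probability generating function $\mathcal P(z)=\mathbb E z^X$. Call $X$ *positive discrete stable with the Chebyshev thinning operator $\mathcal T$* (with parameters $b,m$) if for every integer $n\ge 2$ there is $p_n\in(0,1)$ such that $$X\stackrel d=\sum_{i=1}^n\sum_{j=1}^{X_i}\varepsilon^{(i)}_j,$$ where the $X_i$ are copies of $X$, the $\varepsilon^{(i)}_j$ are non-negative integer-valued with probability generating function $\mathcal Q_{p_n}$, and all these variables are independent. Consider the condition $$(\ast)\qquad \mathcal P(z)=\exp\left\{-\lambda\left(\arccos\frac{(1+b)z^m-2b}{2-(1+b)z^m}\right)^{\gamma}\right\},\quad z\in[0,1],\qquad \gamma\in(0,2],\ \lambda>0 .$$ 1. If $m=1$, then $X$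 is positive discrete stable with thinning operator $\mathcal T$ if and only if $(\ast)$ holds for some $\gamma\in(0,2]$ and $\lambda>0$. 2. For every $m\ge 1$, $X$ is positive discrete stable with thinning operator $\mathcal T$ if and only if there are $\gamma\in(0,2]$ and $\lambda>0$ such that $(\ast)$ holds and, for every $n\ge 2$, the function $\mathcal Q_{p}$ with $p=n^{-1/\gamma}$ is the probability generating function of some law on the non-negative integers. 3. For every $m\ge 1$, there is for every $n\ge 2$ some $p_n\in(0,1)$ with $\mathcal P(z)=\mathcal P(\mathcal Q_{p_n}(z))^n$ for all $z\in[0,1]$, if and only if $(\ast)$ holds for some $\gamma\in(0,2]$ and $\lambda>0$. -/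

import Mathlib

open MeasureTheory ProbabilityTheory Set

noncomputable section

/-- The probability generating function `z ↦ E[z ^ X]` of a random variable with values in the
non-negative integers. -/
def pgf {Ω : Type*} [MeasurableSpace Ω] (X : Ω → ℕ) (P : Measure Ω) (z : ℝ) : ℝ :=
  ∫ ω, z ^ X ω ∂P

/-- `X` is positive discrete stable (in the first sense) with the thinning operators whose
probability generating functions are `Q p`, `0 < p < 1`: for every `n ≥ 2` there is `p ∈ (0, 1)`
such that `X` has the law of `∑_{i < n} ∑_{j < X i} ε i j`, where the `X i` are copies of `X`,
the `ε i j` are non-negative integer-valued with probability generating function `Q p`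
on `[0, 1]`, and all the variables `X i`, `ε i j` together are independent. -/
def IsPositiveDiscreteStable {Ω : Type*} [MeasurableSpace Ω] (Q : ℝ → ℝ → ℝ)
    (X : Ω → ℕ) (P : Measure Ω) : Prop :=
  ∀ n : ℕ, 2 ≤ n → ∃ p ∈ Ioo (0 : ℝ) 1,
    ∃ (Ω' : Type) (_ : MeasurableSpace Ω') (P' : Measure Ω')
      (X' : Fin n → Ω' → ℕ) (ε : Fin n → ℕ → Ω' → ℕ),
      IsProbabilityMeasure P' ∧
      (∀ i, Measurable (X' i)) ∧
      (∀ i j, Measurable (ε i j)) ∧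
      (∀ i, IdentDistrib (X' i) X P' P) ∧
      (∀ i j, ∀ z ∈ Icc (0 : ℝ) 1, pgf (ε i j) P' z = Q p z) ∧
      iIndepFun (Sum.elim X' (fun k : Fin n × ℕ => ε k.1 k.2)) P' ∧
      IdentDistrib X (fun ω => ∑ i, ∑ j ∈ Finset.range (X' i ω), ε i j ω) P P'

/-- `T_p(x) = cos (p * arccos x)`. -/
def chebyshevT (p x : ℝ) : ℝ := Real.cos (p * Real.arccos x)

/-- `((1 + b) z - 2 b) / (2 - (1 + b) z)`. -/
def chebyshevR (b z : ℝ) : ℝ := ((1 + b) * z - 2 * b) / (2 - (1 + b) * z)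

/-- The function `Q` of the Chebyshev thinning operator with parameters `p`, `b`, `m`. -/
def chebyshevQ (b : ℝ) (m : ℕ) (p z : ℝ) : ℝ :=
  (2 * (b + chebyshevT p (chebyshevR b (z ^ m))) /
    ((1 + b) * (1 + chebyshevT p (chebyshevR b (z ^ m))))) ^ (1 / (m : ℝ))

/-- `f` is, on `[0, 1]`, the probability generating function of some probability law on `ℕ`. -/
def IsPGF (f : ℝ → ℝ) : Prop :=
  ∃ ν : Measure ℕ, IsProbabilityMeasure ν ∧ ∀ z ∈ Icc (0 : ℝ) 1, pgf id ν z = f z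

/-- On `[0, 1]` the probability generating function of `X` is
`exp (-lam * (arccos (((1 + b) z ^ m - 2 b) / (2 - (1 + b) z ^ m))) ^ γ)`. -/
def HasChebyshevStablePGF {Ω : Type*} [MeasurableSpace Ω] (γ lam b : ℝ) (m : ℕ)
    (X : Ω → ℕ) (P : Measure Ω) : Prop :=
  ∀ z ∈ Icc (0 : ℝ) 1,
    pgf X P z =
      Real.exp (-lam * Real.arccos (((1 + b) * z ^ m - 2 * b) / (2 - (1 + b) * z ^ m)) ^ γ)

end

/-! The function `R` is the cosine of a double angle: with `κ = (1 + b) / (1 - b)` and `x = arctan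
√(κ (1 - z ^ m))` one has `R (z ^ m) = cos (2 x)`. In the coordinate `x` the map `Q p` is therefore
multiplication by `p`, and the equation `P = (P ∘ Q p) ^ n` becomes `g x = n * g (p * x)` for `g =
-log P`, a strictly increasing function of `x` on a bounded interval. Comparing powers of the `p n`
by monotonicity forces `p n = n ^ (-1 / γ)` with one common `γ`. Then `g` is known at rational
multiples of its largest value, and monotonicity makes it a power function
(`eq_mul_rpow_of_functional_equation`).

The bound `γ ≤ 2` comes from the behaviour at `z = 1`: by convexity `1 - P z` is at least a positive
multiple of `1 - z`, which is at least a multiple of `x ^ 2`, while `1 - P z` is at most a multiple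
of `x ^ γ`.

Discrete stability is the functional equation together with the existence of the thinning variables,
because a random sum has the composed generating function (`pgf_randomSum`) and generating functions
determine laws (`measure_eq_of_pgf_eq`). As `p n` is forced, only `Q p` at `p = n ^ (-1 / γ)` has to
be a generating function.

For `m = 1` this is automatic (`isPGF_chebyshevQ_one`). The maps `Q (exp (-t))` form a semigroup,
the flow of the field `V z = (2 / κ) (1 + y) √y arctan √y` with `y = κ (1 - z)`. An integral
representation shows that all Taylor coefficients of `V` at `0`, except possibly the linear one, are
non-negative. Hence `z + d * V z` has non-negative coefficients for small `d ≥ 0`, its iterates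
inherit this, and they converge to `Q p`. -/

/-! ### The angular coordinate of the Chebyshev thinning operator -/

/-- The constant `(1 + b) / (1 - b)`. -/
noncomputable def chebyshevKappa (b : ℝ) : ℝ := (1 + b) / (1 - b)

/-- Half the angle `arccos (R (z ^ m))`; it conjugates `Q p` to the multiplication by `p`. -/
noncomputable def halfAngle (b : ℝ) (m : ℕ) (z : ℝ) : ℝ :=
  Real.arctan √(chebyshevKappa b * (1 - z ^ m))

/-- The largest value of `halfAngle`, attained at `0`. -/
noncomputable def maxHalfAngle (b : ℝ) : ℝ := Real.arctan √(chebyshevKappa b)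

/-- The inverse of `halfAngle`. -/
noncomputable def ofHalfAngle (b : ℝ) (m : ℕ) (x : ℝ) : ℝ :=
  (1 - Real.tan x ^ 2 / chebyshevKappa b) ^ (1 / (m : ℝ))

theorem cos_two_mul_arctan (w : ℝ) :
    Real.cos (2 * Real.arctan w) = (1 - w ^ 2) / (1 + w ^ 2) := by
  have h : (1 : ℝ) + w ^ 2 ≠ 0 := by positivity
  rw [Real.cos_two_mul, Real.cos_sq_arctan]
  field_simp
  ring

theorem chebyshevKappa_pos {b : ℝ} (hb : b ∈ Ioo (-1 : ℝ) 1) : 0 < chebyshevKappa b :=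
  div_pos (by linarith [hb.1]) (by linarith [hb.2])

theorem maxHalfAngle_lt (b : ℝ) : maxHalfAngle b < Real.pi / 2 := Real.arctan_lt_pi_div_two _

theorem maxHalfAngle_pos {b : ℝ} (hb : b ∈ Ioo (-1 : ℝ) 1) : 0 < maxHalfAngle b :=
  Real.arctan_pos.2 (Real.sqrt_pos.2 (chebyshevKappa_pos hb))

theorem tan_maxHalfAngle_sq {b : ℝ} (hb : b ∈ Ioo (-1 : ℝ) 1) :
    Real.tan (maxHalfAngle b) ^ 2 = chebyshevKappa b := by
  rw [maxHalfAngle, Real.tan_arctan, Real.sq_sqrt (chebyshevKappa_pos hb).le]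

theorem one_sub_pow_mem_Icc {z : ℝ} (hz : z ∈ Icc (0 : ℝ) 1) (m : ℕ) :
    1 - z ^ m ∈ Icc (0 : ℝ) 1 :=
  ⟨sub_nonneg.2 (pow_le_one₀ hz.1 hz.2), sub_le_self _ (pow_nonneg hz.1 m)⟩

theorem halfAngle_mem_Icc {b : ℝ} (hb : b ∈ Ioo (-1 : ℝ) 1) (m : ℕ) {z : ℝ}
    (hz : z ∈ Icc (0 : ℝ) 1) : halfAngle b m z ∈ Icc 0 (maxHalfAngle b) := by
  have hk := chebyshevKappa_pos hb
  have h := one_sub_pow_mem_Icc hz m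
  refine ⟨Real.arctan_nonneg.2 (Real.sqrt_nonneg _), Real.arctan_strictMono.monotone ?_⟩
  exact Real.sqrt_le_sqrt (by nlinarith [h.2])

theorem tan_halfAngle_sq {b : ℝ} (hb : b ∈ Ioo (-1 : ℝ) 1) (m : ℕ) {z : ℝ}
    (hz : z ∈ Icc (0 : ℝ) 1) :
    Real.tan (halfAngle b m z) ^ 2 = chebyshevKappa b * (1 - z ^ m) := by
  rw [halfAngle, Real.tan_arctan, Real.sq_sqrt]
  exact mul_nonneg (chebyshevKappa_pos hb).le (one_sub_pow_mem_Icc hz m).1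

theorem tan_mono_of_mem {x y : ℝ} (hx : 0 ≤ x) (hxy : x ≤ y) (hy : y < Real.pi / 2) :
    Real.tan x ≤ Real.tan y :=
  Real.strictMonoOn_tan.monotoneOn ⟨by linarith [Real.pi_pos], by linarith⟩
    ⟨by linarith [Real.pi_pos], hy⟩ hxy

theorem tan_sq_lt_tan_sq {x y : ℝ} (hx : 0 ≤ x) (hxy : x < y) (hy : y < Real.pi / 2) :
    Real.tan x ^ 2 < Real.tan y ^ 2 := by
  refine pow_lt_pow_left₀ (Real.tan_lt_tan_of_nonneg_of_lt_pi_div_two hx hy hxy)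
    (Real.tan_nonneg_of_nonneg_of_le_pi_div_two hx (hxy.le.trans hy.le)) two_ne_zero

theorem one_sub_tan_sq_div_mem_Icc {b : ℝ} (hb : b ∈ Ioo (-1 : ℝ) 1) {x : ℝ}
    (hx : x ∈ Icc 0 (maxHalfAngle b)) :
    1 - Real.tan x ^ 2 / chebyshevKappa b ∈ Icc (0 : ℝ) 1 := by
  have hk := chebyshevKappa_pos hb
  have h : Real.tan x ^ 2 ≤ chebyshevKappa b := by
    rw [← tan_maxHalfAngle_sq hb]
    exact pow_le_pow_left₀ (Real.tan_nonneg_of_nonneg_of_le_pi_div_two hx.1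
      (hx.2.trans (maxHalfAngle_lt b).le)) (tan_mono_of_mem hx.1 hx.2 (maxHalfAngle_lt b)) 2
  exact ⟨sub_nonneg.2 ((div_le_one hk).2 h), sub_le_self _ (by positivity)⟩

theorem ofHalfAngle_mem_Icc {b : ℝ} (hb : b ∈ Ioo (-1 : ℝ) 1) (m : ℕ) {x : ℝ}
    (hx : x ∈ Icc 0 (maxHalfAngle b)) : ofHalfAngle b m x ∈ Icc (0 : ℝ) 1 := by
  have h := one_sub_tan_sq_div_mem_Icc hb hx
  exact ⟨Real.rpow_nonneg h.1 _, Real.rpow_le_one h.1 h.2 (by positivity)⟩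

theorem ofHalfAngle_pow {b : ℝ} (hb : b ∈ Ioo (-1 : ℝ) 1) {m : ℕ} (hm : 1 ≤ m) {x : ℝ}
    (hx : x ∈ Icc 0 (maxHalfAngle b)) :
    ofHalfAngle b m x ^ m = 1 - Real.tan x ^ 2 / chebyshevKappa b := by
  rw [ofHalfAngle, one_div, Real.rpow_inv_natCast_pow (one_sub_tan_sq_div_mem_Icc hb hx).1
    (by omega)]

theorem halfAngle_ofHalfAngle {b : ℝ} (hb : b ∈ Ioo (-1 : ℝ) 1) {m : ℕ} (hm : 1 ≤ m) {x : ℝ}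
    (hx : x ∈ Icc 0 (maxHalfAngle b)) : halfAngle b m (ofHalfAngle b m x) = x := by
  have hk := chebyshevKappa_pos hb
  have hpi := hx.2.trans_lt (maxHalfAngle_lt b)
  rw [halfAngle, ofHalfAngle_pow hb hm hx, sub_sub_cancel, mul_div_cancel₀ _ hk.ne',
    Real.sqrt_sq (Real.tan_nonneg_of_nonneg_of_le_pi_div_two hx.1 hpi.le),
    Real.arctan_tan (by linarith [hx.1, Real.pi_pos]) hpi]

theorem ofHalfAngle_halfAngle {b : ℝ} (hb : b ∈ Ioo (-1 : ℝ) 1) {m : ℕ} (hm : 1 ≤ m) {z : ℝ}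
    (hz : z ∈ Icc (0 : ℝ) 1) : ofHalfAngle b m (halfAngle b m z) = z := by
  have hk := chebyshevKappa_pos hb
  rw [ofHalfAngle, tan_halfAngle_sq hb m hz, mul_div_cancel_left₀ _ hk.ne', sub_sub_cancel,
    one_div, Real.pow_rpow_inv_natCast hz.1 (by omega)]

theorem ofHalfAngle_strictAntiOn {b : ℝ} (hb : b ∈ Ioo (-1 : ℝ) 1) {m : ℕ} (hm : 1 ≤ m) :
    StrictAntiOn (ofHalfAngle b m) (Icc 0 (maxHalfAngle b)) := by
  intro x hx y hy hxy
  have hk := chebyshevKappa_pos hb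
  have h := tan_sq_lt_tan_sq hx.1 hxy (hy.2.trans_lt (maxHalfAngle_lt b))
  refine Real.rpow_lt_rpow (one_sub_tan_sq_div_mem_Icc hb hy).1 ?_ (by positivity)
  exact sub_lt_sub_left (div_lt_div_of_pos_right h hk) _

theorem mul_mem_Icc_zero {p x c : ℝ} (hp : p ∈ Icc (0 : ℝ) 1) (hx : x ∈ Icc 0 c) :
    p * x ∈ Icc 0 c :=
  ⟨mul_nonneg hp.1 hx.1, (mul_le_of_le_one_left hx.1 hp.2).trans hx.2⟩

/-- This is `cos (2 x) = (1 - tan x ^ 2) / (1 + tan x ^ 2)` with `tan x ^ 2 = κ (1 - z ^ m)`; the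
value of `κ` is the one that makes the two fractions agree. -/
theorem chebyshevR_pow_eq {b : ℝ} (hb : b ∈ Ioo (-1 : ℝ) 1) (m : ℕ) {z : ℝ}
    (hz : z ∈ Icc (0 : ℝ) 1) :
    chebyshevR b (z ^ m) = Real.cos (2 * halfAngle b m z) := by
  have h := one_sub_pow_mem_Icc hz m
  have hk := chebyshevKappa_pos hb
  have h1 : 0 < 1 - b := by linarith [hb.2]
  have h2 : 2 - (1 + b) * z ^ m ≠ 0 := by
    have : (1 + b) * z ^ m ≤ 1 + b := by
      apply mul_le_of_le_one_right <;> linarith [hb.1, h.1]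
    linarith
  have h3 : 1 + chebyshevKappa b * (1 - z ^ m) ≠ 0 := by nlinarith [h.1]
  rw [halfAngle, cos_two_mul_arctan, Real.sq_sqrt (mul_nonneg hk.le h.1), chebyshevR,
    div_eq_div_iff h2 h3, chebyshevKappa]
  field_simp
  ring

theorem arccos_chebyshevR {b : ℝ} (hb : b ∈ Ioo (-1 : ℝ) 1) (m : ℕ) {z : ℝ}
    (hz : z ∈ Icc (0 : ℝ) 1) :
    Real.arccos (chebyshevR b (z ^ m)) = 2 * halfAngle b m z := by
  have h := halfAngle_mem_Icc hb m hz
  rw [chebyshevR_pow_eq hb m hz, Real.arccos_cos (by linarith [h.1])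
    (by linarith [h.2, maxHalfAngle_lt b])]

/-- With `θ = p * halfAngle b m z`, the base of the power in `Q p` is `2 (b + cos 2θ) / ((1 + b) (1
+ cos 2θ)) = 1 - tan θ ^ 2 / κ`. -/
theorem chebyshevQ_eq {b : ℝ} (hb : b ∈ Ioo (-1 : ℝ) 1) (m : ℕ) {p : ℝ}
    (hp : p ∈ Icc (0 : ℝ) 1) {z : ℝ} (hz : z ∈ Icc (0 : ℝ) 1) :
    chebyshevQ b m p z = ofHalfAngle b m (p * halfAngle b m z) := by
  have hx := mul_mem_Icc_zero hp (halfAngle_mem_Icc hb m hz)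
  have hpi := hx.2.trans_lt (maxHalfAngle_lt b)
  have hc : 0 < Real.cos (p * halfAngle b m z) :=
    Real.cos_pos_of_mem_Ioo ⟨by linarith [hx.1, Real.pi_pos], hpi⟩
  have h1 : 0 < 1 - b := by linarith [hb.2]
  have h2 : 0 < 1 + b := by linarith [hb.1]
  rw [chebyshevQ, ofHalfAngle, chebyshevT, arccos_chebyshevR hb m hz, mul_left_comm,
    Real.cos_two_mul, Real.tan_eq_sin_div_cos, div_pow, Real.sin_sq, chebyshevKappa]
  congr 1
  field_simp
  ring

theorem chebyshevQ_mem_Icc {b : ℝ} (hb : b ∈ Ioo (-1 : ℝ) 1) (m : ℕ) {p : ℝ}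
    (hp : p ∈ Icc (0 : ℝ) 1) {z : ℝ} (hz : z ∈ Icc (0 : ℝ) 1) :
    chebyshevQ b m p z ∈ Icc (0 : ℝ) 1 := by
  rw [chebyshevQ_eq hb m hp hz]
  exact ofHalfAngle_mem_Icc hb m (mul_mem_Icc_zero hp (halfAngle_mem_Icc hb m hz))

theorem halfAngle_chebyshevQ {b : ℝ} (hb : b ∈ Ioo (-1 : ℝ) 1) {m : ℕ} (hm : 1 ≤ m) {p : ℝ}
    (hp : p ∈ Icc (0 : ℝ) 1) {z : ℝ} (hz : z ∈ Icc (0 : ℝ) 1) :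
    halfAngle b m (chebyshevQ b m p z) = p * halfAngle b m z := by
  rw [chebyshevQ_eq hb m hp hz,
    halfAngle_ofHalfAngle hb hm (mul_mem_Icc_zero hp (halfAngle_mem_Icc hb m hz))]

/-! ### The functional equation `g x = n * g (p n * x)` -/

theorem iterate_functional_equation {g : ℝ → ℝ} {T p c : ℝ} (hp : p ∈ Icc (0 : ℝ) 1)
    (hg : ∀ x ∈ Icc 0 T, g x = c * g (p * x)) (j : ℕ) {x : ℝ} (hx : x ∈ Icc 0 T) :
    g x = c ^ j * g (p ^ j * x) := by
  induction j with
  | zero => simp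
  | succ j ih =>
    have hj : p ^ j * x ∈ Icc 0 T :=
      mul_mem_Icc_zero ⟨pow_nonneg hp.1 j, pow_le_one₀ hp.1 hp.2⟩ hx
    rw [ih, hg _ hj, pow_succ, pow_succ', mul_assoc, mul_assoc]

/-- If the natural multiples of two positive reals `u`, `v` compare in the same way as those of
`s`, `t`, then the ratios agree. -/
theorem div_eq_div_of_nat_mul_le_iff {u v s t : ℝ} (hu : 0 < u) (hv : 0 < v) (hs : 0 < s)
    (ht : 0 < t) (h : ∀ i j : ℕ, i * u ≤ j * v ↔ i * s ≤ j * t) : v / u = t / s := by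
  -- The two ratios define the same Dedekind cut: for `q ≥ 0` the hypothesis applies to numerator
  -- and denominator, and for `q ≤ 0` both inequalities hold.
  have key : ∀ q : ℚ, (q : ℝ) ≤ v / u ↔ (q : ℝ) ≤ t / s := by
    intro q
    rcases le_total q 0 with hq | hq
    · have hq' : (q : ℝ) ≤ 0 := by exact_mod_cast hq
      exact ⟨fun _ => hq'.trans (by positivity), fun _ => hq'.trans (by positivity)⟩
    · have hd : (0 : ℝ) < q.den := by exact_mod_cast q.den_pos
      have hn : (q.num : ℝ) = (q.num.toNat : ℕ) := by
        have := Int.toNat_of_nonneg (Rat.num_nonneg.2 hq)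
        exact_mod_cast this.symm
      have hq' : (q : ℝ) = (q.num.toNat : ℕ) / (q.den : ℝ) := by rw [← hn, Rat.cast_def]
      have := h q.num.toNat q.den
      rw [hq', div_le_div_iff₀ hd hu, div_le_div_iff₀ hd hs, mul_comm v, mul_comm t]
      exact this
  rcases lt_trichotomy (v / u) (t / s) with hlt | heq | hlt
  · obtain ⟨q, h1, h2⟩ := exists_rat_btwn hlt
    exact absurd ((key q).2 h2.le) (not_le.2 h1)
  · exact heq
  · obtain ⟨q, h1, h2⟩ := exists_rat_btwn hlt
    exact absurd ((key q).1 h2.le) (not_le.2 h1)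

/-- A strictly increasing solution on `[0, T]` of the equations `g x = n * g (p n * x)`, `n ≥ 2`,
is a power function. -/
theorem eq_mul_rpow_of_functional_equation {g : ℝ → ℝ} {T : ℝ} (hT : 0 < T)
    (hmono : StrictMonoOn g (Icc 0 T))
    (hg : ∀ n : ℕ, 2 ≤ n → ∃ p ∈ Ioo (0 : ℝ) 1, ∀ x ∈ Icc 0 T, g x = n * g (p * x)) :
    ∃ γ > (0 : ℝ), ∃ lam > (0 : ℝ), ∀ x ∈ Icc 0 T, g x = lam * x ^ γ := by
  choose! p hp hg using hg
  have hp' : ∀ n, 2 ≤ n → p n ∈ Icc (0 : ℝ) 1 := fun n hn => Ioo_subset_Icc_self (hp n hn)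
  have h0T : (0 : ℝ) ∈ Icc 0 T := ⟨le_rfl, hT.le⟩
  have hTT : T ∈ Icc 0 T := ⟨hT.le, le_rfl⟩
  have hg0 : g 0 = 0 := by
    have := hg 2 le_rfl 0 h0T
    simp only [mul_zero, Nat.cast_ofNat] at this
    linarith
  have hpos : ∀ x ∈ Ioc 0 T, 0 < g x := fun x hx => by
    rw [← hg0]; exact hmono h0T ⟨hx.1.le, hx.2⟩ hx.1
  have hgT := hpos T ⟨hT, le_rfl⟩
  have hpow : ∀ n j, 2 ≤ n → p n ^ j * T ∈ Icc 0 T := fun n j hn =>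
    mul_mem_Icc_zero ⟨pow_nonneg (hp n hn).1.le j, pow_le_one₀ (hp n hn).1.le (hp n hn).2.le⟩ hTT
  have hlog : ∀ n, 2 ≤ n → 0 < -Real.log (p n) := fun n hn =>
    neg_pos.2 (Real.log_neg (hp n hn).1 (hp n hn).2)
  have hlogn : ∀ n : ℕ, 2 ≤ n → 0 < Real.log n := fun n hn =>
    Real.log_pos (by exact_mod_cast hn)
  -- The exponent is read off from `n = 2`: this choice means `p 2 = 2 ^ (-1 / γ)`.
  set γ := Real.log 2 / -Real.log (p 2) with hγ
  have hγ0 : 0 < γ := div_pos (by simpa using hlogn 2 le_rfl) (hlog 2 le_rfl)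
  -- the parameter is determined by `n`
  have hratio : ∀ n : ℕ, 2 ≤ n → Real.log n = γ * -Real.log (p n) := by
    intro n hn
    have := div_eq_div_of_nat_mul_le_iff (hlogn 2 le_rfl) (hlogn n hn) (hlog 2 le_rfl) (hlog n hn)
      (by
        intro i j
        have e2 := iterate_functional_equation (hp' 2 le_rfl) (hg 2 le_rfl) i hTT
        have en := iterate_functional_equation (hp' n hn) (hg n hn) j hTT
        have h2i : (0 : ℝ) < ((2 : ℕ) : ℝ) ^ i := by positivity
        have hnj : (0 : ℝ) < (n : ℝ) ^ j := by
          have : 0 < n := by omega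
          positivity
        have hp2i : 0 < p 2 ^ i := pow_pos (hp 2 le_rfl).1 i
        have hpnj : 0 < p n ^ j := pow_pos (hp n hn).1 j
        -- Since `g (p n ^ j * T) = g T / n ^ j`, strict monotonicity of `g` translates the
        -- comparison of `2 ^ i` with `n ^ j` into that of `p n ^ j` with `p 2 ^ i`.
        have l1 : (i : ℝ) * Real.log (2 : ℕ) ≤ j * Real.log n ↔
            ((2 : ℕ) : ℝ) ^ i ≤ (n : ℝ) ^ j := by
          rw [← Real.log_pow, ← Real.log_pow, Real.log_le_log_iff h2i hnj]
        have l2 : (i : ℝ) * -Real.log (p 2) ≤ j * -Real.log (p n) ↔ p n ^ j ≤ p 2 ^ i := by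
          rw [mul_neg, mul_neg, neg_le_neg_iff, ← Real.log_pow, ← Real.log_pow,
            Real.log_le_log_iff hpnj hp2i]
        have l3 : p n ^ j ≤ p 2 ^ i ↔ g (p n ^ j * T) ≤ g (p 2 ^ i * T) := by
          rw [hmono.le_iff_le (hpow n j hn) (hpow 2 i le_rfl), mul_le_mul_iff_left₀ hT]
        rw [l1, l2, l3, eq_div_of_mul_eq hnj.ne' ((mul_comm _ _).trans en.symm),
          eq_div_of_mul_eq h2i.ne' ((mul_comm _ _).trans e2.symm),
          div_le_div_iff_of_pos_left hgT hnj h2i])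
    have h2 := (hlogn 2 le_rfl).ne'
    have h2' := (hlog 2 le_rfl).ne'
    rw [div_eq_div_iff h2 h2'] at this
    rw [hγ, div_mul_eq_mul_div, eq_div_iff h2', this, mul_comm, Nat.cast_ofNat]
  -- The case `n = 1` is included because the numerator or denominator of a rational may be `1`.
  have hpn : ∀ n : ℕ, 1 ≤ n → ∀ x ∈ Icc 0 T, g x = n * g ((n : ℝ) ^ (-(1 / γ)) * x) := by
    intro n hn x hx
    rcases hn.eq_or_lt with rfl | hn
    · simp
    have hn' : 2 ≤ n := hn
    rw [hg n hn' x hx]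
    congr 3
    rw [Real.rpow_def_of_pos (by positivity), hratio n hn',
      show γ * -Real.log (p n) * -(1 / γ) = Real.log (p n) by field_simp,
      Real.exp_log (hp n hn').1]
  -- values at rational arguments
  have hrat : ∀ q : ℚ, 0 < q → q ≤ 1 → g ((q : ℝ) ^ (1 / γ) * T) = q * g T := by
    intro q hq hq1
    have hn : 1 ≤ q.num.toNat := by
      have := Rat.num_pos.2 hq
      omega
    have hnR : (0 : ℝ) < q.num.toNat := by exact_mod_cast hn
    have hd : (0 : ℝ) < q.den := by exact_mod_cast q.den_pos
    have hn' : (q.num : ℝ) = (q.num.toNat : ℕ) := by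
      have := Int.toNat_of_nonneg (Rat.num_nonneg.2 hq.le)
      exact_mod_cast this.symm
    have hq' : (q : ℝ) = (q.num.toNat : ℕ) / (q.den : ℝ) := by rw [← hn', Rat.cast_def]
    have hqR : (0 : ℝ) < q := by exact_mod_cast hq
    have hmem : (q : ℝ) ^ (1 / γ) * T ∈ Icc 0 T :=
      mul_mem_Icc_zero ⟨by positivity,
        Real.rpow_le_one hqR.le (by exact_mod_cast hq1) (by positivity)⟩ hTT
    rw [hpn _ hn _ hmem, hpn _ q.den_pos T hTT]
    rw [show ((q.num.toNat : ℕ) : ℝ) ^ (-(1 / γ)) * ((q : ℝ) ^ (1 / γ) * T)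
      = ((q.den : ℕ) : ℝ) ^ (-(1 / γ)) * T by
        rw [hq', Real.div_rpow hnR.le hd.le, Real.rpow_neg hnR.le, Real.rpow_neg hd.le]
        field_simp]
    rw [hq']
    field_simp
  refine ⟨γ, hγ0, g T / T ^ γ, by positivity, fun x hx => ?_⟩
  rcases hx.1.eq_or_lt with rfl | hx0
  · rw [hg0, Real.zero_rpow hγ0.ne', mul_zero]
  have hxT : 0 < x / T := div_pos hx0 hT
  have hgx := hpos x ⟨hx0, hx.2⟩
  have hgle : g x ≤ g T := hmono.monotoneOn hx hTT hx.2
  have hr1 : (x / T) ^ γ ≤ 1 := Real.rpow_le_one hxT.le ((div_le_one hT).2 hx.2) hγ0.le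
  have hr0 : 0 < (x / T) ^ γ := by positivity
  have hinv : ((x / T) ^ γ) ^ (1 / γ) * T = x := by
    rw [← Real.rpow_mul hxT.le, mul_one_div_cancel hγ0.ne', Real.rpow_one, div_mul_cancel₀ _ hT.ne']
  have hmemr : ∀ r : ℝ, 0 < r → r ≤ 1 → r ^ (1 / γ) * T ∈ Icc 0 T := fun r h0 h1 =>
    mul_mem_Icc_zero ⟨by positivity, Real.rpow_le_one h0.le h1 (by positivity)⟩ hTT
  suffices h : g x / g T = (x / T) ^ γ by
    rw [Real.div_rpow hx0.le hT.le] at h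
    have : T ^ γ ≠ 0 := by positivity
    field_simp at h ⊢
    linarith
  -- A rational strictly between the two sides would contradict monotonicity, so no continuity of
  -- `g` is needed.
  rcases lt_trichotomy (g x / g T) ((x / T) ^ γ) with hlt | heq | hlt
  · exfalso
    obtain ⟨q, h1, h2⟩ := exists_rat_btwn hlt
    have hq0 : (0 : ℝ) < q := (div_pos hgx hgT).trans h1
    have hq1 : (q : ℝ) ≤ 1 := h2.le.trans hr1
    have := hmono (hmemr q hq0 hq1) (hmemr _ hr0 hr1)
      (mul_lt_mul_of_pos_right (Real.rpow_lt_rpow hq0.le h2 (by positivity)) hT)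
    rw [hinv, hrat q (by exact_mod_cast hq0) (by exact_mod_cast hq1)] at this
    rw [div_lt_iff₀ hgT] at h1
    linarith
  · exact heq
  · exfalso
    obtain ⟨q, h1, h2⟩ := exists_rat_btwn hlt
    have hq0 : (0 : ℝ) < q := hr0.trans h1
    have hq1 : (q : ℝ) ≤ 1 := h2.le.trans ((div_le_one hgT).2 hgle)
    have := hmono (hmemr _ hr0 hr1) (hmemr q hq0 hq1)
      (mul_lt_mul_of_pos_right (Real.rpow_lt_rpow hr0.le h1 (by positivity)) hT)
    rw [hinv, hrat q (by exact_mod_cast hq0) (by exact_mod_cast hq1)] at this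
    rw [lt_div_iff₀ hgT] at h2
    linarith

/-! ### Power series with non-negative coefficients on `[0, 1)` -/

/-- On `[0, 1)` the function `f` is the sum of a power series with non-negative coefficients. -/
def HasNonnegCoeffs (f : ℝ → ℝ) : Prop :=
  ∃ a : ℕ → ℝ, (∀ k, 0 ≤ a k) ∧ ∀ z ∈ Ico (0 : ℝ) 1, HasSum (fun k => a k * z ^ k) (f z)

namespace HasNonnegCoeffs

theorem congr {f g : ℝ → ℝ} (hf : HasNonnegCoeffs f) (h : ∀ z ∈ Ico (0 : ℝ) 1, f z = g z) :
    HasNonnegCoeffs g := by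
  obtain ⟨a, ha, hs⟩ := hf
  exact ⟨a, ha, fun z hz => h z hz ▸ hs z hz⟩

theorem add {f g : ℝ → ℝ} (hf : HasNonnegCoeffs f) (hg : HasNonnegCoeffs g) :
    HasNonnegCoeffs (fun z => f z + g z) := by
  obtain ⟨a, ha, hs⟩ := hf
  obtain ⟨b, hb, ht⟩ := hg
  refine ⟨fun k => a k + b k, fun k => add_nonneg (ha k) (hb k), fun z hz => ?_⟩
  simpa only [add_mul] using (hs z hz).add (ht z hz)

theorem const_mul {f : ℝ → ℝ} (hf : HasNonnegCoeffs f) {c : ℝ} (hc : 0 ≤ c) :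
    HasNonnegCoeffs (fun z => c * f z) := by
  obtain ⟨a, ha, hs⟩ := hf
  refine ⟨fun k => c * a k, fun k => mul_nonneg hc (ha k), fun z hz => ?_⟩
  simpa only [mul_assoc] using (hs z hz).mul_left c

theorem mul {f g : ℝ → ℝ} (hf : HasNonnegCoeffs f) (hg : HasNonnegCoeffs g) :
    HasNonnegCoeffs (fun z => f z * g z) := by
  obtain ⟨a, ha, hs⟩ := hf
  obtain ⟨b, hb, ht⟩ := hg
  refine ⟨fun n => ∑ kl ∈ Finset.HasAntidiagonal.antidiagonal n, a kl.1 * b kl.2,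
    fun n => Finset.sum_nonneg fun kl _ => mul_nonneg (ha _) (hb _), fun z hz => ?_⟩
  have h1 := (hs z hz).summable.norm
  have h2 := (ht z hz).summable.norm
  have h3 := tsum_mul_tsum_eq_tsum_sum_antidiagonal_of_summable_norm h1 h2
  have h4 := (summable_norm_sum_mul_antidiagonal_of_summable_norm h1 h2).of_norm
  rw [(hs z hz).tsum_eq, (ht z hz).tsum_eq] at h3
  dsimp only
  rw [h3]
  refine h4.hasSum.congr_fun fun n => ?_
  rw [Finset.sum_mul]
  refine Finset.sum_congr rfl fun kl hkl => ?_
  rw [← Finset.HasAntidiagonal.mem_antidiagonal.1 hkl, pow_add]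
  ring

theorem monomial (n : ℕ) : HasNonnegCoeffs (fun z => z ^ n) := by
  refine ⟨fun k => if k = n then 1 else 0, fun k => by dsimp only; split_ifs <;> norm_num, fun z _ => ?_⟩
  convert hasSum_ite_eq n (z ^ n) using 2 with k
  split_ifs with h <;> simp [h]

theorem const {c : ℝ} (hc : 0 ≤ c) : HasNonnegCoeffs (fun _ => c) :=
  ((monomial 0).const_mul hc).congr fun z _ => by simp

theorem pow {f : ℝ → ℝ} (hf : HasNonnegCoeffs f) (n : ℕ) : HasNonnegCoeffs (fun z => f z ^ n) := by
  induction n with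
  | zero => simpa using monomial 0
  | succ n ih => simpa only [pow_succ] using ih.mul hf

theorem finset_sum {ι : Type*} (s : Finset ι) {f : ι → ℝ → ℝ}
    (hf : ∀ i ∈ s, HasNonnegCoeffs (f i)) : HasNonnegCoeffs (fun z => ∑ i ∈ s, f i z) := by
  classical
  induction s using Finset.induction_on with
  | empty => simpa using const le_rfl
  | insert i s hi ih =>
    simp only [Finset.sum_insert hi]
    exact (hf i (by simp)).add (ih fun j hj => hf j (by simp [hj]))

/-- Partial sums at `z < 1` are bounded by `f z ≤ 1`; let `z` tend to `1` from the left. On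
singletons this bounds each coefficient, on all finite sets it gives summability. -/
theorem sum_le_one {f : ℝ → ℝ} {a : ℕ → ℝ} (ha : ∀ k, 0 ≤ a k)
    (hs : ∀ z ∈ Ico (0 : ℝ) 1, HasSum (fun k => a k * z ^ k) (f z))
    (hf : ∀ z ∈ Ico (0 : ℝ) 1, f z ≤ 1) (s : Finset ℕ) : ∑ k ∈ s, a k ≤ 1 := by
  have hc : Continuous fun z : ℝ => ∑ k ∈ s, a k * z ^ k := by fun_prop
  have hlim : Filter.Tendsto (fun z : ℝ => ∑ k ∈ s, a k * z ^ k) (nhdsWithin 1 (Iio 1))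
      (nhds (∑ k ∈ s, a k)) := by
    simpa using (hc.tendsto 1).mono_left nhdsWithin_le_nhds
  refine le_of_tendsto hlim ?_
  filter_upwards [Ico_mem_nhdsLT (zero_lt_one' ℝ)] with z hz
  exact (sum_le_hasSum s (fun k _ => mul_nonneg (ha k) (pow_nonneg hz.1 k)) (hs z hz)).trans
    (hf z hz)

/-- The power series with non-negative coefficients that are at most `1` on `[0, 1)` are closed
under pointwise limits. -/
theorem of_tendsto {f : ℕ → ℝ → ℝ} {g : ℝ → ℝ} (hf : ∀ n, HasNonnegCoeffs (f n))
    (hf1 : ∀ n, ∀ z ∈ Ico (0 : ℝ) 1, f n z ≤ 1)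
    (hlim : ∀ z ∈ Ico (0 : ℝ) 1, Filter.Tendsto (fun n => f n z) Filter.atTop (nhds (g z))) :
    HasNonnegCoeffs g := by
  choose a ha hs using hf
  -- The coefficient sequences lie in the compact cube `[0, 1] ^ ℕ`. Along a convergent subsequence
  -- the sums converge as well, dominated by the geometric series.
  have hK : IsCompact (Set.pi univ fun _ : ℕ => Icc (0 : ℝ) 1) :=
    isCompact_univ_pi fun _ => isCompact_Icc
  have haK : ∀ n, a n ∈ Set.pi univ fun _ : ℕ => Icc (0 : ℝ) 1 := fun n k _ =>
    ⟨ha n k, by simpa using sum_le_one (ha n) (hs n) (hf1 n) {k}⟩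
  obtain ⟨c, hc, φ, hφ, hcl⟩ := hK.tendsto_subseq haK
  refine ⟨c, fun k => (hc k trivial).1, fun z hz => ?_⟩
  have hgeo := summable_geometric_of_lt_one hz.1 hz.2
  have hb : ∀ d ∈ Set.pi univ fun _ : ℕ => Icc (0 : ℝ) 1, ∀ k, ‖d k * z ^ k‖ ≤ z ^ k := by
    intro d hd k
    have h0 := pow_nonneg hz.1 k
    rw [Real.norm_of_nonneg (mul_nonneg (hd k trivial).1 h0)]
    exact mul_le_of_le_one_left h0 (hd k trivial).2
  have h1 : Filter.Tendsto (fun n => ∑' k, a (φ n) k * z ^ k) Filter.atTop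
      (nhds (∑' k, c k * z ^ k)) := by
    refine tendsto_tsum_of_dominated_convergence hgeo (fun k => ?_)
      (Filter.Eventually.of_forall fun n => hb _ (haK (φ n)))
    exact ((tendsto_pi_nhds.1 hcl) k).mul_const _
  simp only [(hs _ z hz).tsum_eq] at h1
  rw [tendsto_nhds_unique ((hlim z hz).comp hφ.tendsto_atTop) h1]
  exact (Summable.of_norm_bounded hgeo (hb c hc)).hasSum

/-- Partial sums of the outer series give finite combinations of powers of `g`; passing to the limit
with `of_tendsto` avoids rearranging a double series. -/
theorem comp {f g : ℝ → ℝ} (hf : HasNonnegCoeffs f) (hg : HasNonnegCoeffs g)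
    (hf1 : ∀ z ∈ Ico (0 : ℝ) 1, f z ≤ 1) (hg1 : MapsTo g (Ico 0 1) (Ico 0 1)) :
    HasNonnegCoeffs (fun z => f (g z)) := by
  obtain ⟨a, ha, hs⟩ := hf
  refine of_tendsto (f := fun n z => ∑ k ∈ Finset.range n, a k * g z ^ k)
    (fun n => finset_sum _ fun k _ => (hg.pow k).const_mul (ha k)) (fun n z hz => ?_)
    fun z hz => (hs _ (hg1 hz)).tendsto_sum_nat
  exact (sum_le_hasSum _ (fun k _ => mul_nonneg (ha k) (pow_nonneg (hg1 hz).1 k))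
    (hs _ (hg1 hz))).trans (hf1 _ (hg1 hz))

theorem iterate {f : ℝ → ℝ} (hf : HasNonnegCoeffs f) (hf1 : MapsTo f (Ico 0 1) (Ico 0 1))
    (n : ℕ) : HasNonnegCoeffs f^[n] := by
  induction n with
  | zero => exact (monomial 1).congr fun z _ => by simp
  | succ n ih =>
    rw [Function.iterate_succ]
    exact ih.comp hf (fun z hz => (hf1.iterate n hz).2.le) hf1

end HasNonnegCoeffs

theorem pgf_id_eq_tsum (ν : Measure ℕ) [IsProbabilityMeasure ν] {z : ℝ}
    (hz : z ∈ Icc (0 : ℝ) 1) : HasSum (fun k => ν.real {k} * z ^ k) (pgf id ν z) := by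
  have hi : Integrable (fun k : ℕ => z ^ k) ν :=
    Integrable.of_bound (by fun_prop) 1 (Filter.Eventually.of_forall fun k => by
      rw [Real.norm_of_nonneg (pow_nonneg hz.1 k)]; exact pow_le_one₀ hz.1 hz.2)
  have := hasSum_integral_iUnion (μ := ν) (f := fun k : ℕ => z ^ k) (s := fun k : ℕ => {k})
    (fun k => measurableSet_singleton k) (by
      intro i j hij; simpa using hij) hi.integrableOn
  rw [iUnion_of_singleton, setIntegral_univ] at this
  simpa [pgf, integral_singleton, Measure.real] using this

/-- Left continuity at `1` with `f 1 = 1` excludes a loss of mass: the coefficients sum to exactly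
`1` and so define a law. -/
theorem HasNonnegCoeffs.isPGF {f : ℝ → ℝ} (hf : HasNonnegCoeffs f)
    (hf1 : ∀ z ∈ Ico (0 : ℝ) 1, f z ≤ 1)
    (hlim : Filter.Tendsto f (nhdsWithin 1 (Iio 1)) (nhds (f 1))) (h1 : f 1 = 1) : IsPGF f := by
  obtain ⟨a, ha, hs⟩ := hf
  have hsum : Summable a :=
    summable_of_sum_le ha fun s => sum_le_one ha hs hf1 s
  have hle : ∑' k, a k ≤ 1 := hsum.tsum_le_of_sum_le fun s => sum_le_one ha hs hf1 s
  have hge : 1 ≤ ∑' k, a k := by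
    rw [← h1]
    refine le_of_tendsto hlim ?_
    filter_upwards [Ico_mem_nhdsLT (zero_lt_one' ℝ)] with z hz
    rw [← (hs z hz).tsum_eq]
    exact (hs z hz).summable.tsum_le_tsum
      (fun k => mul_le_of_le_one_right (ha k) (pow_le_one₀ hz.1 hz.2.le)) hsum
  have h1s : HasSum a 1 := le_antisymm hle hge ▸ hsum.hasSum
  let ν : PMF ℕ := ⟨fun k => ENNReal.ofReal (a k), by
    rw [← ENNReal.ofReal_one, ← h1s.tsum_eq, ENNReal.ofReal_tsum_of_nonneg ha hsum]
    exact ENNReal.summable.hasSum⟩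
  refine ⟨ν.toMeasure, inferInstance, fun z hz => ?_⟩
  have hν : ∀ k, ν.toMeasure.real {k} = a k := fun k => by
    rw [Measure.real, PMF.toMeasure_apply_singleton _ _ (measurableSet_singleton k)]
    exact ENNReal.toReal_ofReal (ha k)
  have h := pgf_id_eq_tsum ν.toMeasure hz
  simp only [hν] at h
  rcases hz.2.eq_or_lt with rfl | hz1
  · rw [h1]
    exact h.unique (by simpa using h1s)
  · exact h.unique (hs z ⟨hz.1, hz1⟩)

/-! ### The thinning functions `Q p` for `m = 1` are probability generating functions -/

theorem HasNonnegCoeffs.integral {a : ℕ → ℝ → ℝ} {f : ℝ → ℝ → ℝ} {M : ℝ}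
    (hc : ∀ k, Continuous (a k)) (h0 : ∀ k, ∀ s ∈ Icc (0 : ℝ) 1, 0 ≤ a k s)
    (hM : ∀ k, ∀ s ∈ Icc (0 : ℝ) 1, a k s ≤ M)
    (hs : ∀ z ∈ Ico (0 : ℝ) 1, ∀ s ∈ Icc (0 : ℝ) 1, HasSum (fun k => a k s * z ^ k) (f z s)) :
    HasNonnegCoeffs (fun z => ∫ s in (0 : ℝ)..1, f z s) := by
  refine ⟨fun k => ∫ s in (0 : ℝ)..1, a k s,
    fun k => intervalIntegral.integral_nonneg zero_le_one (h0 k), fun z hz => ?_⟩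
  have hsub : ∀ s ∈ Set.uIoc (0 : ℝ) 1, s ∈ Icc (0 : ℝ) 1 := fun s hs => by
    rw [uIoc_of_le zero_le_one] at hs
    exact Ioc_subset_Icc_self hs
  simp only [← intervalIntegral.integral_mul_const]
  refine intervalIntegral.hasSum_integral_of_dominated_convergence (fun k _ => M * z ^ k)
    (fun k => ((hc k).mul continuous_const).aestronglyMeasurable) (fun k => ?_) ?_ ?_ ?_
  · refine Filter.Eventually.of_forall fun s hs' => ?_
    have h1 := pow_nonneg hz.1 k
    rw [Real.norm_of_nonneg (mul_nonneg (h0 k s (hsub s hs')) h1)]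
    exact mul_le_mul_of_nonneg_right (hM k s (hsub s hs')) h1
  · exact Filter.Eventually.of_forall fun s _ =>
      (summable_geometric_of_lt_one hz.1 hz.2).mul_left M
  · exact intervalIntegrable_const
  · exact Filter.Eventually.of_forall fun s hs' => hs z hz s (hsub s hs')

theorem integral_div_one_add_mul_sq {y : ℝ} (hy : 0 ≤ y) :
    ∫ s in (0 : ℝ)..1, y / (1 + y * s ^ 2) = √y * Real.arctan √y := by
  have hd : ∀ s ∈ Set.uIcc (0 : ℝ) 1,
      HasDerivAt (fun s => √y * Real.arctan (√y * s)) (y / (1 + y * s ^ 2)) s := by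
    intro s _
    refine ((((hasDerivAt_id' s).const_mul √y).arctan).const_mul √y).congr_deriv ?_
    rw [mul_one, mul_pow, Real.sq_sqrt hy, one_div_mul_eq_div, mul_div_assoc',
      Real.mul_self_sqrt hy]
  have hc : Continuous fun s : ℝ => y / (1 + y * s ^ 2) :=
    Continuous.div (by fun_prop) (by fun_prop) fun s => by positivity
  rw [intervalIntegral.integral_eq_sub_of_hasDerivAt hd (hc.intervalIntegrable _ _)]
  simp

/-- Taylor coefficients at `z = 0` of `(1 + y) y / (1 + y s ^ 2) + K (1 + 2 K) z`, where
`y = K (1 - z)`. -/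
noncomputable def arctanKernelCoeff (K : ℝ) : ℕ → ℝ → ℝ
  | 0, s => K * (1 + K) / (1 + K * s ^ 2)
  | 1, s => K * (1 + 2 * K) - K * (1 + 2 * K) / (1 + K * s ^ 2)
      + K * s ^ 2 / (1 + K * s ^ 2) * (K * (1 + K)) / (1 + K * s ^ 2)
  | k + 2, s => K ^ 2 * (1 - s ^ 2) / (1 + K * s ^ 2) ^ 3 * (K * s ^ 2 / (1 + K * s ^ 2)) ^ k

theorem continuous_arctanKernelCoeff {K : ℝ} (hK : 0 < K) (k : ℕ) :
    Continuous (arctanKernelCoeff K k) := by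
  have hD : ∀ s : ℝ, 1 + K * s ^ 2 ≠ 0 := fun s => by positivity
  have hD' : ∀ s : ℝ, (1 + K * s ^ 2) ^ 3 ≠ 0 := fun s => pow_ne_zero _ (hD s)
  match k with
  | 0 => unfold arctanKernelCoeff; fun_prop (disch := assumption)
  | 1 => unfold arctanKernelCoeff; fun_prop (disch := assumption)
  | k + 2 => unfold arctanKernelCoeff; fun_prop (disch := assumption)

/-- In the linear coefficient the added `K (1 + 2 K)` outweighs the only negative term, because `1 +
K s ^ 2 ≥ 1`. The later coefficients carry the factor `1 - s ^ 2 ≥ 0`. The upper bound is `K (1 + 2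
K) + K (1 + K)`, dictated by the linear coefficient. -/
theorem arctanKernelCoeff_mem_Icc {K : ℝ} (hK : 0 < K) (k : ℕ) {s : ℝ} (hs : s ∈ Icc (0 : ℝ) 1) :
    arctanKernelCoeff K k s ∈ Icc 0 (2 * K + 3 * K ^ 2) := by
  have hD1 : 1 ≤ 1 + K * s ^ 2 := le_add_of_nonneg_right (by positivity)
  have hs2 : 0 ≤ 1 - s ^ 2 := sub_nonneg.2 (pow_le_one₀ hs.1 hs.2)
  have hr : K * s ^ 2 / (1 + K * s ^ 2) ∈ Icc (0 : ℝ) 1 :=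
    ⟨by positivity, (div_le_one (by positivity)).2 (by linarith)⟩
  have hdiv : ∀ c : ℝ, 0 ≤ c → c / (1 + K * s ^ 2) ∈ Icc 0 c := fun c hc =>
    ⟨by positivity, div_le_self hc hD1⟩
  match k with
  | 0 =>
    have := hdiv (K * (1 + K)) (by positivity)
    exact ⟨this.1, this.2.trans (by nlinarith)⟩
  | 1 =>
    have h1 := hdiv (K * (1 + 2 * K)) (by positivity)
    have h2 : K * s ^ 2 / (1 + K * s ^ 2) * (K * (1 + K)) ∈ Icc 0 (K * (1 + K)) :=
      mul_mem_Icc_zero hr ⟨by positivity, le_rfl⟩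
    have h3 := hdiv _ h2.1
    unfold arctanKernelCoeff
    exact ⟨by linarith [h1.2, h3.1], by nlinarith [h1.1, h3.2, h2.2]⟩
  | k + 2 =>
    unfold arctanKernelCoeff
    have h1 : K ^ 2 * (1 - s ^ 2) / (1 + K * s ^ 2) ^ 3 ≤ K ^ 2 :=
      (div_le_self (by positivity) (one_le_pow₀ hD1)).trans
        (mul_le_of_le_one_right (by positivity) (by nlinarith))
    have h0 : 0 ≤ K ^ 2 * (1 - s ^ 2) / (1 + K * s ^ 2) ^ 3 := by positivity
    refine ⟨mul_nonneg h0 (pow_nonneg hr.1 k), ?_⟩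
    refine (mul_le_of_le_one_right h0 (pow_le_one₀ hr.1 hr.2)).trans (h1.trans ?_)
    nlinarith

theorem hasSum_arctanKernelCoeff {K : ℝ} (hK : 0 < K) {z s : ℝ} (hz : z ∈ Ico (0 : ℝ) 1) :
    HasSum (fun k => arctanKernelCoeff K k s * z ^ k)
      ((1 + K * (1 - z)) * (K * (1 - z) / (1 + K * (1 - z) * s ^ 2)) + K * (1 + 2 * K) * z) := by
  have hD : 0 < 1 + K * s ^ 2 := by positivity
  have hr0 : 0 ≤ K * s ^ 2 / (1 + K * s ^ 2) := by positivity
  have hr1 : K * s ^ 2 / (1 + K * s ^ 2) ≤ 1 := (div_le_one hD).2 (by linarith)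
  have hz1 : 0 < 1 - z := by linarith [hz.2]
  have hrz : K * s ^ 2 / (1 + K * s ^ 2) * z < 1 :=
    (mul_le_of_le_one_left hz.1 hr1).trans_lt hz.2
  have hgeo := (hasSum_geometric_of_lt_one (mul_nonneg hr0 hz.1) hrz).mul_left
    (K ^ 2 * (1 - s ^ 2) / (1 + K * s ^ 2) ^ 3 * z ^ 2)
  have hE : 0 < 1 + K * (1 - z) * s ^ 2 := by positivity
  -- Beyond the first two terms the series is geometric with ratio `K s ^ 2 / (1 + K s ^ 2) * z`,
  -- since the numerator `(1 + y) y` is quadratic in `z`.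
  rw [← hasSum_nat_add_iff' 2]
  refine Eq.subst (motive := HasSum _) ?_ (hgeo.congr_fun fun k => ?_)
  · have e : 1 - K * s ^ 2 / (1 + K * s ^ 2) * z
        = (1 + K * (1 - z) * s ^ 2) / (1 + K * s ^ 2) := by field_simp; ring
    symm
    rw [e, Finset.sum_range_succ, Finset.sum_range_one]
    simp only [arctanKernelCoeff]
    field_simp
    ring
  · simp only [arctanKernelCoeff]
    rw [mul_pow, pow_add]
    ring

/-- Integrate the kernel expansion over `s ∈ [0, 1]`, using `√y * arctan √y = ∫ y / (1 + y s ^ 2)`.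
-/
theorem hasNonnegCoeffs_arctan {K : ℝ} (hK : 0 < K) :
    HasNonnegCoeffs (fun z => (1 + K * (1 - z)) *
      (√(K * (1 - z)) * Real.arctan √(K * (1 - z))) + K * (1 + 2 * K) * z) := by
  refine (HasNonnegCoeffs.integral (continuous_arctanKernelCoeff hK)
    (fun k s hs => (arctanKernelCoeff_mem_Icc hK k hs).1)
    (fun k s hs => (arctanKernelCoeff_mem_Icc hK k hs).2)
    (fun z hz s _ => hasSum_arctanKernelCoeff hK hz)).congr fun z hz => ?_
  have hy : 0 ≤ K * (1 - z) := mul_nonneg hK.le (by linarith [hz.2])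
  have hc : Continuous fun s : ℝ => K * (1 - z) / (1 + K * (1 - z) * s ^ 2) :=
    Continuous.div (by fun_prop) (by fun_prop) fun s => by positivity
  rw [intervalIntegral.integral_add ((hc.const_mul _).intervalIntegrable _ _)
    intervalIntegrable_const, intervalIntegral.integral_const_mul,
    integral_div_one_add_mul_sq hy]
  simp

/-! ### Estimates for the square of the tangent -/

theorem hasDerivAt_tan_sq {x : ℝ} (hx : x ∈ Ico 0 (Real.pi / 2)) :
    HasDerivAt (fun x => Real.tan x ^ 2) (2 * Real.tan x * (1 + Real.tan x ^ 2)) x := by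
  have hc : Real.cos x ≠ 0 :=
    (Real.cos_pos_of_mem_Ioo ⟨by linarith [hx.1, Real.pi_pos], hx.2⟩).ne'
  refine ((Real.hasDerivAt_tan hc).fun_pow 2).congr_deriv ?_
  rw [← Real.inv_one_add_tan_sq hc]
  simp

theorem hasDerivAt_deriv_tan_sq {x : ℝ} (hx : x ∈ Ico 0 (Real.pi / 2)) :
    HasDerivAt (fun x => 2 * Real.tan x * (1 + Real.tan x ^ 2))
      (2 * (1 + Real.tan x ^ 2) * (1 + 3 * Real.tan x ^ 2)) x := by
  have hc : Real.cos x ≠ 0 :=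
    (Real.cos_pos_of_mem_Ioo ⟨by linarith [hx.1, Real.pi_pos], hx.2⟩).ne'
  have h1 := Real.hasDerivAt_tan hc
  refine ((h1.const_mul 2).fun_mul ((hasDerivAt_tan_sq hx).const_add 1)).congr_deriv ?_
  rw [← Real.inv_one_add_tan_sq hc]
  simp
  ring

/-- First order expansion of `tan ^ 2` with an explicit error bound. -/
theorem abs_tan_sq_sub_le {c x h : ℝ} (hc : c < Real.pi / 2) (hx : x ∈ Icc 0 c) (hh : 0 ≤ h)
    (hxh : h ≤ x) :
    |Real.tan (x - h) ^ 2 - Real.tan x ^ 2 + h * (2 * Real.tan x * (1 + Real.tan x ^ 2))|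
      ≤ 2 * (1 + Real.tan c ^ 2) * (1 + 3 * Real.tan c ^ 2) * h ^ 2 := by
  rcases hh.eq_or_lt with rfl | hh
  · simp
  have hsub : ∀ t ∈ Icc (x - h) x, t ∈ Ico 0 (Real.pi / 2) := fun t ht =>
    ⟨by linarith [ht.1], by linarith [ht.2, hx.2]⟩
  -- The mean value theorem turns the error into `h` times a difference of derivatives at two points
  -- at distance at most `h`; a bound on the second derivative gives another factor `h`.
  obtain ⟨ξ, hξ, he⟩ := exists_hasDerivAt_eq_slope (fun x => Real.tan x ^ 2)
    (fun x => 2 * Real.tan x * (1 + Real.tan x ^ 2)) (sub_lt_self x hh)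
    (fun t ht => (hasDerivAt_tan_sq (hsub t ht)).continuousAt.continuousWithinAt)
    (fun t ht => hasDerivAt_tan_sq (hsub t (Ioo_subset_Icc_self ht)))
  have hξ' := Ioo_subset_Icc_self hξ
  have hlip := (convex_Icc (x - h) x).norm_image_sub_le_of_norm_hasDerivWithin_le
    (f := fun x => 2 * Real.tan x * (1 + Real.tan x ^ 2))
    (C := 2 * (1 + Real.tan c ^ 2) * (1 + 3 * Real.tan c ^ 2))
    (fun t ht => (hasDerivAt_deriv_tan_sq (hsub t ht)).hasDerivWithinAt)
    (fun t ht => by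
      have h1 : Real.tan t ^ 2 ≤ Real.tan c ^ 2 :=
        pow_le_pow_left₀ (Real.tan_nonneg_of_nonneg_of_le_pi_div_two (hsub t ht).1
          (hsub t ht).2.le) (tan_mono_of_mem (hsub t ht).1 (ht.2.trans hx.2) hc) 2
      rw [Real.norm_of_nonneg (by positivity)]
      gcongr)
    hξ' (right_mem_Icc.2 (sub_le_self x hh.le))
  simp only [sub_sub_cancel, Real.norm_eq_abs] at he hlip
  rw [eq_div_iff hh.ne'] at he
  rw [show Real.tan (x - h) ^ 2 - Real.tan x ^ 2 + h * (2 * Real.tan x * (1 + Real.tan x ^ 2))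
    = h * (2 * Real.tan x * (1 + Real.tan x ^ 2) - 2 * Real.tan ξ * (1 + Real.tan ξ ^ 2)) by
      linarith, abs_mul, abs_of_pos hh]
  have hξh : |x - ξ| ≤ h := by
    rw [abs_of_nonneg (by linarith [hξ.2])]
    linarith [hξ.1]
  calc _ ≤ h * (2 * (1 + Real.tan c ^ 2) * (1 + 3 * Real.tan c ^ 2) * |x - ξ|) := by gcongr
    _ ≤ h * (2 * (1 + Real.tan c ^ 2) * (1 + 3 * Real.tan c ^ 2) * h) := by gcongr
    _ = _ := by ring

/-- The function `tan t ^ 2 - tan (p t) ^ 2` is increasing, because the derivative of `tan ^ 2` is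
increasing and `p ≤ 1`. In the variable `z` this says that `Q p` is a contraction when `m = 1`. -/
theorem tan_sq_mul_sub_le {p x y : ℝ} (hp : p ∈ Icc (0 : ℝ) 1) (hx : 0 ≤ x) (hxy : x ≤ y)
    (hy : y < Real.pi / 2) :
    Real.tan (p * y) ^ 2 - Real.tan (p * x) ^ 2 ≤ Real.tan y ^ 2 - Real.tan x ^ 2 := by
  have hd : ∀ t ∈ Icc x y, HasDerivAt (fun t => Real.tan t ^ 2 - Real.tan (p * t) ^ 2)
      (2 * Real.tan t * (1 + Real.tan t ^ 2)
        - 2 * Real.tan (p * t) * (1 + Real.tan (p * t) ^ 2) * (p * 1)) t := by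
    intro t ht
    have ht' : t ∈ Icc 0 y := ⟨hx.trans ht.1, ht.2⟩
    have hpt := mul_mem_Icc_zero hp ht'
    exact (hasDerivAt_tan_sq ⟨ht'.1, ht'.2.trans_lt hy⟩).sub
      ((hasDerivAt_tan_sq (x := p * t) ⟨hpt.1, hpt.2.trans_lt hy⟩).comp t
        ((hasDerivAt_id t).const_mul p))
  have hmono : MonotoneOn (fun t => Real.tan t ^ 2 - Real.tan (p * t) ^ 2) (Icc x y) := by
    refine monotoneOn_of_deriv_nonneg (convex_Icc x y)
      (fun t ht => (hd t ht).continuousAt.continuousWithinAt)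
      (fun t ht => (hd t (interior_subset ht)).differentiableAt.differentiableWithinAt)
      fun t ht => ?_
    have ht := interior_subset ht
    rw [(hd t ht).deriv, mul_one]
    have ht0 : 0 ≤ t := hx.trans ht.1
    have htp : t < Real.pi / 2 := ht.2.trans_lt hy
    have hpt := mul_mem_Icc_zero hp (show t ∈ Icc 0 t from ⟨ht0, le_rfl⟩)
    have h1 := tan_mono_of_mem hpt.1 hpt.2 htp
    have h0 := Real.tan_nonneg_of_nonneg_of_le_pi_div_two hpt.1 (hpt.2.trans htp.le)
    have h2 := h0.trans h1
    rw [sub_nonneg]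
    calc _ ≤ 2 * Real.tan (p * t) * (1 + Real.tan (p * t) ^ 2) :=
          mul_le_of_le_one_right (by positivity) hp.2
      _ ≤ _ := by gcongr
  have := hmono (left_mem_Icc.2 hxy) (right_mem_Icc.2 hxy) hxy
  dsimp only at this
  linarith

theorem arctan_le_self {w : ℝ} (hw : 0 ≤ w) : Real.arctan w ≤ w :=
  (Real.le_tan (Real.arctan_nonneg.2 hw) (Real.arctan_lt_pi_div_two w)).trans_eq
    (Real.tan_arctan w)

theorem chebyshevQ_one_eq {b : ℝ} (hb : b ∈ Ioo (-1 : ℝ) 1) {p : ℝ} (hp : p ∈ Icc (0 : ℝ) 1)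
    {z : ℝ} (hz : z ∈ Icc (0 : ℝ) 1) :
    chebyshevQ b 1 p z = 1 - Real.tan (p * halfAngle b 1 z) ^ 2 / chebyshevKappa b := by
  rw [chebyshevQ_eq hb 1 hp hz, ofHalfAngle]
  simp

theorem eq_one_sub_tan_halfAngle_sq {b : ℝ} (hb : b ∈ Ioo (-1 : ℝ) 1)
    {z : ℝ} (hz : z ∈ Icc (0 : ℝ) 1) :
    z = 1 - Real.tan (halfAngle b 1 z) ^ 2 / chebyshevKappa b := by
  rw [tan_halfAngle_sq hb 1 hz, mul_div_cancel_left₀ _ (chebyshevKappa_pos hb).ne']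
  simp

theorem chebyshevQ_chebyshevQ {b : ℝ} (hb : b ∈ Ioo (-1 : ℝ) 1) {m : ℕ} (hm : 1 ≤ m) {p q : ℝ}
    (hp : p ∈ Icc (0 : ℝ) 1) (hq : q ∈ Icc (0 : ℝ) 1) {z : ℝ} (hz : z ∈ Icc (0 : ℝ) 1) :
    chebyshevQ b m p (chebyshevQ b m q z) = chebyshevQ b m (p * q) z := by
  rw [chebyshevQ_eq hb m hp (chebyshevQ_mem_Icc hb m hq hz), halfAngle_chebyshevQ hb hm hq hz,
    chebyshevQ_eq hb m ⟨mul_nonneg hp.1 hq.1, mul_le_one₀ hp.2 hq.1 hq.2⟩ hz, mul_assoc]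

theorem halfAngle_antitoneOn {b : ℝ} (hb : b ∈ Ioo (-1 : ℝ) 1) (m : ℕ) :
    AntitoneOn (halfAngle b m) (Icc 0 1) := by
  intro z hz w _ hzw
  have hk := chebyshevKappa_pos hb
  have := pow_le_pow_left₀ hz.1 hzw m
  unfold halfAngle
  exact Real.arctan_strictMono.monotone (Real.sqrt_le_sqrt (by gcongr))

theorem abs_chebyshevQ_sub_le {b : ℝ} (hb : b ∈ Ioo (-1 : ℝ) 1) {p : ℝ} (hp : p ∈ Icc (0 : ℝ) 1)
    {z w : ℝ} (hz : z ∈ Icc (0 : ℝ) 1) (hw : w ∈ Icc (0 : ℝ) 1) :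
    |chebyshevQ b 1 p z - chebyshevQ b 1 p w| ≤ |z - w| := by
  wlog hzw : w ≤ z generalizing z w
  · rw [abs_sub_comm, abs_sub_comm z]
    exact this hw hz (le_of_not_ge hzw)
  have hk := chebyshevKappa_pos hb
  have hx := halfAngle_mem_Icc hb 1 hz
  have hy := halfAngle_mem_Icc hb 1 hw
  have hxy := halfAngle_antitoneOn hb 1 hw hz hzw
  have hypi := hy.2.trans_lt (maxHalfAngle_lt b)
  have hpxy : p * halfAngle b 1 z ≤ p * halfAngle b 1 w := mul_le_mul_of_nonneg_left hxy hp.1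
  have hpy := mul_mem_Icc_zero hp hy
  have hpx := mul_mem_Icc_zero hp hx
  have h1 := tan_sq_mul_sub_le hp hx.1 hxy hypi
  have h2 : Real.tan (p * halfAngle b 1 z) ^ 2 ≤ Real.tan (p * halfAngle b 1 w) ^ 2 :=
    pow_le_pow_left₀ (Real.tan_nonneg_of_nonneg_of_le_pi_div_two hpx.1
      (hpx.2.trans (maxHalfAngle_lt b).le))
      (tan_mono_of_mem hpx.1 hpxy (hpy.2.trans_lt (maxHalfAngle_lt b))) 2
  rw [chebyshevQ_one_eq hb hp hz, chebyshevQ_one_eq hb hp hw, abs_of_nonneg (sub_nonneg.2 hzw)]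
  have h3 : z - w = (Real.tan (halfAngle b 1 w) ^ 2 - Real.tan (halfAngle b 1 z) ^ 2)
      / chebyshevKappa b := by
    have hz' := eq_one_sub_tan_halfAngle_sq hb hz
    have hw' := eq_one_sub_tan_halfAngle_sq hb hw
    rw [sub_div]
    linarith
  rw [h3, sub_sub_sub_cancel_left, ← sub_div,
    abs_of_nonneg (div_nonneg (sub_nonneg.2 h2) hk.le)]
  gcongr

/-! ### The Euler scheme converging to `Q p` -/

/-- One step of the explicit Euler scheme for the flow `t ↦ Q (exp (-t))`. -/
noncomputable def chebyshevEuler (b d z : ℝ) : ℝ :=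
  z + d * (2 / chebyshevKappa b *
    ((1 + chebyshevKappa b * (1 - z)) * (√(chebyshevKappa b * (1 - z)) * halfAngle b 1 z)))

theorem hasNonnegCoeffs_chebyshevEuler {b : ℝ} (hb : b ∈ Ioo (-1 : ℝ) 1) {d : ℝ} (hd : 0 ≤ d)
    (hd1 : 2 * d * (1 + 2 * chebyshevKappa b) ≤ 1) : HasNonnegCoeffs (chebyshevEuler b d) := by
  have hk := chebyshevKappa_pos hb
  refine (((hasNonnegCoeffs_arctan hk).const_mul (c := d * (2 / chebyshevKappa b))
    (by positivity)).add ((HasNonnegCoeffs.monomial 1).const_mul (sub_nonneg.2 hd1))).congr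
    fun z _ => ?_
  simp only [chebyshevEuler, halfAngle, pow_one]
  field_simp
  ring

/-- By `arctan w ≤ w` the increment is at most `2 d (1 + 2 κ) (1 - z)`, so a small step does not
reach `1`. -/
theorem mapsTo_chebyshevEuler {b : ℝ} (hb : b ∈ Ioo (-1 : ℝ) 1) {d : ℝ} (hd : 0 ≤ d)
    (hd1 : 2 * d * (1 + 2 * chebyshevKappa b) < 1) :
    MapsTo (chebyshevEuler b d) (Ico 0 1) (Ico 0 1) := by
  intro z hz
  have hk := chebyshevKappa_pos hb
  have h1 : 0 < 1 - z := by linarith [hz.2]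
  have hx0 := (halfAngle_mem_Icc hb 1 ⟨hz.1, hz.2.le⟩).1
  have hx1 : halfAngle b 1 z ≤ √(chebyshevKappa b * (1 - z)) := by
    rw [halfAngle, pow_one]
    exact arctan_le_self (Real.sqrt_nonneg _)
  refine ⟨add_nonneg hz.1 (by positivity), ?_⟩
  have h2 : √(chebyshevKappa b * (1 - z)) * halfAngle b 1 z ≤ chebyshevKappa b * (1 - z) :=
    (mul_le_mul_of_nonneg_left hx1 (Real.sqrt_nonneg _)).trans
      (Real.mul_self_sqrt (by positivity)).le
  have h3 : 1 + chebyshevKappa b * (1 - z) ≤ 1 + 2 * chebyshevKappa b := by nlinarith [hz.1]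
  calc chebyshevEuler b d z
      ≤ z + d * (2 / chebyshevKappa b *
          ((1 + 2 * chebyshevKappa b) * (chebyshevKappa b * (1 - z)))) := by
        unfold chebyshevEuler; gcongr
    _ = z + 2 * d * (1 + 2 * chebyshevKappa b) * (1 - z) := by field_simp
    _ < z + 1 * (1 - z) := by gcongr
    _ = 1 := by ring

/-- The constant in the local error bound of the Euler scheme. -/
noncomputable def eulerErrorConst (b : ℝ) : ℝ :=
  2 * (1 + chebyshevKappa b) * (1 + 3 * chebyshevKappa b) * maxHalfAngle b ^ 2 / chebyshevKappa b

theorem abs_chebyshevEuler_sub_le {b : ℝ} (hb : b ∈ Ioo (-1 : ℝ) 1) {d : ℝ}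
    (hd : d ∈ Icc (0 : ℝ) 1) {z : ℝ} (hz : z ∈ Icc (0 : ℝ) 1) :
    |chebyshevEuler b d z - chebyshevQ b 1 (1 - d) z| ≤ eulerErrorConst b * d ^ 2 := by
  have hk := chebyshevKappa_pos hb
  have hx := halfAngle_mem_Icc hb 1 hz
  have hdx := mul_mem_Icc_zero hd (show halfAngle b 1 z ∈ Icc 0 (halfAngle b 1 z) from
    ⟨hx.1, le_rfl⟩)
  have h := abs_tan_sq_sub_le (maxHalfAngle_lt b) hx hdx.1 hdx.2
  have ht : Real.tan (halfAngle b 1 z) = √(chebyshevKappa b * (1 - z)) := by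
    rw [halfAngle, Real.tan_arctan, pow_one]
  have hE : chebyshevEuler b d z - chebyshevQ b 1 (1 - d) z =
      (Real.tan (halfAngle b 1 z - d * halfAngle b 1 z) ^ 2 - Real.tan (halfAngle b 1 z) ^ 2
        + d * halfAngle b 1 z * (2 * Real.tan (halfAngle b 1 z)
          * (1 + Real.tan (halfAngle b 1 z) ^ 2))) / chebyshevKappa b := by
    rw [chebyshevQ_one_eq hb ⟨by linarith [hd.2], by linarith [hd.1]⟩ hz, chebyshevEuler,
      ← ht, tan_halfAngle_sq hb 1 hz, sub_mul, one_mul, pow_one]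
    field_simp
    ring
  rw [hE, abs_div, abs_of_pos hk, eulerErrorConst, div_mul_eq_mul_div]
  refine div_le_div_of_nonneg_right (h.trans ?_) hk.le
  rw [tan_maxHalfAngle_sq hb, mul_pow, mul_comm (d ^ 2), ← mul_assoc]
  have := pow_le_pow_left₀ hx.1 hx.2 2
  gcongr

/-- Since `Q (1 - d)` is 1-Lipschitz, earlier errors are not amplified and the local errors simply
add up. -/
theorem abs_iterate_chebyshevEuler_sub_le {b : ℝ} (hb : b ∈ Ioo (-1 : ℝ) 1) {d : ℝ}
    (hd : d ∈ Icc (0 : ℝ) 1) (hd1 : 2 * d * (1 + 2 * chebyshevKappa b) < 1) (n : ℕ) {z : ℝ}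
    (hz : z ∈ Ico (0 : ℝ) 1) :
    |(chebyshevEuler b d)^[n] z - chebyshevQ b 1 ((1 - d) ^ n) z|
      ≤ n * (eulerErrorConst b * d ^ 2) := by
  have hq : 1 - d ∈ Icc (0 : ℝ) 1 := ⟨by linarith [hd.2], by linarith [hd.1]⟩
  have hz' := Ico_subset_Icc_self hz
  induction n with
  | zero =>
    rw [pow_zero, chebyshevQ_one_eq hb ⟨zero_le_one, le_rfl⟩ hz', one_mul,
      ← eq_one_sub_tan_halfAngle_sq hb hz']
    simp
  | succ n ih =>
    have hqn : (1 - d) ^ n ∈ Icc (0 : ℝ) 1 := ⟨pow_nonneg hq.1 n, pow_le_one₀ hq.1 hq.2⟩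
    have he := Ico_subset_Icc_self ((mapsTo_chebyshevEuler hb hd.1 hd1).iterate n hz)
    rw [Function.iterate_succ_apply', pow_succ', ← chebyshevQ_chebyshevQ hb le_rfl hq hqn hz']
    have h1 := abs_chebyshevEuler_sub_le hb hd he
    have h2 := abs_chebyshevQ_sub_le hb hq he (chebyshevQ_mem_Icc hb 1 hqn hz')
    have h3 := abs_sub_le (chebyshevEuler b d ((chebyshevEuler b d)^[n] z))
      (chebyshevQ b 1 (1 - d) ((chebyshevEuler b d)^[n] z))
      (chebyshevQ b 1 (1 - d) (chebyshevQ b 1 ((1 - d) ^ n) z))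
    push_cast
    linarith

theorem hasNonnegCoeffs_chebyshevQ {b : ℝ} (hb : b ∈ Ioo (-1 : ℝ) 1) {p : ℝ}
    (hp : p ∈ Ioo (0 : ℝ) 1) : HasNonnegCoeffs (chebyshevQ b 1 p) := by
  have hk := chebyshevKappa_pos hb
  have hL : 0 < -Real.log p := neg_pos.2 (Real.log_neg hp.1 hp.2)
  obtain ⟨N, hN⟩ := exists_nat_gt (2 * (-Real.log p) * (1 + 2 * chebyshevKappa b))
  -- With this step size `(1 - d n) ^ n = p` exactly for `n ≥ 1`. The index shift by `N + 1` below
  -- makes the step small enough, and the total error is of order `n * (log p / n) ^ 2`.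
  let d : ℕ → ℝ := fun n => 1 - p ^ ((n : ℝ)⁻¹)
  have hd0 : ∀ n, d n ∈ Icc (0 : ℝ) 1 := fun n =>
    ⟨sub_nonneg.2 (Real.rpow_le_one hp.1.le hp.2.le (by positivity)),
      sub_le_self _ (Real.rpow_nonneg hp.1.le _)⟩
  have hdL : ∀ n, d n ≤ -Real.log p / n := fun n => by
    have := Real.add_one_le_exp (Real.log p * (n : ℝ)⁻¹)
    simp only [d]
    rw [Real.rpow_def_of_pos hp.1, neg_div, div_eq_mul_inv]
    linarith
  have hdN : ∀ n, 2 * d (n + N + 1) * (1 + 2 * chebyshevKappa b) < 1 := fun n => by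
    have hn : (0 : ℝ) < ((n + N + 1 : ℕ) : ℝ) := by positivity
    have h1 := hdL (n + N + 1)
    have h2 : (N : ℝ) ≤ ((n + N + 1 : ℕ) : ℝ) := by exact_mod_cast (by omega)
    calc _ ≤ 2 * (-Real.log p / ((n + N + 1 : ℕ) : ℝ)) * (1 + 2 * chebyshevKappa b) := by gcongr
      _ = 2 * (-Real.log p) * (1 + 2 * chebyshevKappa b) / ((n + N + 1 : ℕ) : ℝ) := by ring
      _ < 1 := (div_lt_one hn).2 (hN.trans_le h2)
  refine HasNonnegCoeffs.of_tendsto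
    (f := fun n => (chebyshevEuler b (d (n + N + 1)))^[n + N + 1])
    (fun n => (hasNonnegCoeffs_chebyshevEuler hb (hd0 _).1 (hdN n).le).iterate
      (mapsTo_chebyshevEuler hb (hd0 _).1 (hdN n)) _)
    (fun n z hz => ((mapsTo_chebyshevEuler hb (hd0 _).1 (hdN n)).iterate _ hz).2.le)
    fun z hz => ?_
  have hlim : Filter.Tendsto
      (fun n : ℕ => eulerErrorConst b * (-Real.log p) ^ 2 / ((n + (N + 1) : ℕ) : ℝ))
      Filter.atTop (nhds 0) :=
    ((tendsto_const_div_atTop_nhds_zero_nat _).comp (Filter.tendsto_add_atTop_nat (N + 1)))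
  rw [tendsto_iff_dist_tendsto_zero]
  refine squeeze_zero (fun n => dist_nonneg) (fun n => ?_) hlim
  have hn : (0 : ℝ) < ((n + N + 1 : ℕ) : ℝ) := by positivity
  have hpow : (1 - d (n + N + 1)) ^ (n + N + 1) = p := by
    simp only [d, sub_sub_cancel]
    exact Real.rpow_inv_natCast_pow hp.1.le (by omega)
  have h := abs_iterate_chebyshevEuler_sub_le hb (hd0 _) (hdN n) (n + N + 1) hz
  rw [hpow] at h
  rw [Real.dist_eq]
  refine h.trans ?_
  have hC : 0 ≤ eulerErrorConst b := by unfold eulerErrorConst; positivity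
  have h0 := (hd0 (n + N + 1)).1
  have h1 := hdL (n + N + 1)
  calc _ ≤ ((n + N + 1 : ℕ) : ℝ) * (eulerErrorConst b * (-Real.log p / ((n + N + 1 : ℕ) : ℝ)) ^ 2) :=
        by gcongr
    _ = eulerErrorConst b * (-Real.log p) ^ 2 / ((n + N + 1 : ℕ) : ℝ) := by field_simp
    _ = _ := by rw [add_assoc]

/-- For `m = 1` the thinning variables exist, for all `p ∈ (0, 1)`. -/
theorem isPGF_chebyshevQ_one {b : ℝ} (hb : b ∈ Ioo (-1 : ℝ) 1) {p : ℝ} (hp : p ∈ Ioo (0 : ℝ) 1) :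
    IsPGF (chebyshevQ b 1 p) := by
  have hp' := Ioo_subset_Icc_self hp
  have h11 : (1 : ℝ) ∈ Icc (0 : ℝ) 1 := ⟨zero_le_one, le_rfl⟩
  refine (hasNonnegCoeffs_chebyshevQ hb hp).isPGF
    (fun z hz => (chebyshevQ_mem_Icc hb 1 hp' (Ico_subset_Icc_self hz)).2) ?_ ?_
  · rw [tendsto_iff_dist_tendsto_zero]
    have hlim : Filter.Tendsto (fun z : ℝ => |z - 1|) (nhdsWithin 1 (Iio 1)) (nhds 0) := by
      have : Continuous fun z : ℝ => |z - 1| := by fun_prop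
      simpa using (this.tendsto 1).mono_left nhdsWithin_le_nhds
    refine squeeze_zero' (Filter.Eventually.of_forall fun z => dist_nonneg) ?_ hlim
    filter_upwards [Ico_mem_nhdsLT (zero_lt_one' ℝ)] with z hz
    exact abs_chebyshevQ_sub_le hb hp' (Ico_subset_Icc_self hz) h11
  · rw [chebyshevQ_one_eq hb hp' h11, halfAngle]
    simp

/-! ### Probability generating functions of random sums -/

theorem integrable_pow_of_mem_Icc {Ω : Type*} [MeasurableSpace Ω] {P : Measure Ω}
    [IsFiniteMeasure P] {Y : Ω → ℕ} (hY : Measurable Y) {z : ℝ} (hz : z ∈ Icc (0 : ℝ) 1) :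
    Integrable (fun ω => z ^ Y ω) P := by
  have hm : Measurable fun k : ℕ => z ^ k := measurable_of_countable _
  refine Integrable.of_bound (hm.comp hY).aestronglyMeasurable 1
    (Filter.Eventually.of_forall fun ω => ?_)
  rw [Real.norm_of_nonneg (pow_nonneg hz.1 _)]
  exact pow_le_one₀ hz.1 hz.2

/-- On the event `X = k` the variables of a random sum may be replaced by their generating
functions. -/
theorem setIntegral_pow_randomSum {Ω : Type*} [MeasurableSpace Ω] {P : Measure Ω} {n : ℕ}
    {X : Fin n → Ω → ℕ} {ε : Fin n → ℕ → Ω → ℕ} (hX : ∀ i, Measurable (X i))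
    (hε : ∀ i j, Measurable (ε i j))
    (hind : iIndepFun (Sum.elim X (fun k : Fin n × ℕ => ε k.1 k.2)) P) {z q : ℝ}
    (hq : ∀ i j, pgf (ε i j) P z = q) (k : Fin n → ℕ) :
    ∫ ω in {ω | ∀ i, X i ω = k i}, z ^ (∑ i, ∑ j ∈ Finset.range (X i ω), ε i j ω) ∂P =
      ∫ ω in {ω | ∀ i, X i ω = k i}, ∏ i, q ^ X i ω ∂P := by
  have hmeas : MeasurableSet {ω | ∀ i, X i ω = k i} := by
    rw [Set.ofPred_forall]
    exact MeasurableSet.iInter fun i => hX i (measurableSet_singleton (k i))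
  -- On the event `X = k` only the finitely many `ε i j` with `j < k i` enter; `e` selects them
  -- together with all the `X i`, so the product formula for finite independent families applies.
  let e : Fin n ⊕ (Σ i, Fin (k i)) → Fin n ⊕ (Fin n × ℕ) :=
    Sum.map id fun p => (p.1, (p.2 : ℕ))
  have he : Function.Injective e := by
    refine Function.Injective.sumMap Function.injective_id ?_
    rintro ⟨i, j⟩ ⟨i', j'⟩ h
    obtain ⟨rfl, h2⟩ : i = i' ∧ (j : ℕ) = j' := Prod.mk.inj h
    rw [Fin.ext h2]
  have hmeasY : ∀ i, Measurable (Sum.elim X (fun k : Fin n × ℕ => ε k.1 k.2) i) := by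
    rintro (i | p)
    · exact hX i
    · exact hε _ _
  have h1 := (hind.precomp he).integral_fun_prod_comp (𝕜 := ℝ)
    (f := Sum.elim (fun i x => if x = k i then 1 else 0) (fun _ x => z ^ x))
    (fun i => (hmeasY _).aemeasurable) (fun i => (measurable_of_countable _).aestronglyMeasurable)
  have hindX := hind.precomp (Sum.inl_injective (α := Fin n) (β := Fin n × ℕ))
  change iIndepFun X P at hindX
  have h2 := hindX.integral_fun_prod_comp (𝕜 := ℝ)
    (f := fun i x => if x = k i then q ^ k i else 0)
    (fun i => (hX i).aemeasurable) (fun i => (measurable_of_countable _).aestronglyMeasurable)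
  have hq' : ∀ i j, ∫ ω, z ^ ε i j ω ∂P = q := hq
  simp only [Fintype.prod_sum_type, e, Sum.elim_inl, Sum.elim_inr, Sum.map_inl, Sum.map_inr, id,
    Fintype.prod_sigma, ← Finset.prod_mul_distrib] at h1
  simp only [hq', Finset.prod_const, Finset.card_univ, Fintype.card_fin] at h1
  rw [← integral_indicator hmeas, ← integral_indicator hmeas]
  trans ∏ i, ((∫ ω, if X i ω = k i then 1 else 0 ∂P) * q ^ k i)
  · rw [← h1]
    congr 1
    funext ω
    by_cases h : ∀ i, X i ω = k i
    · rw [indicator_of_mem (show ω ∈ {ω | ∀ i, X i ω = k i} from h), ← Finset.prod_pow_eq_pow_sum]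
      refine Finset.prod_congr rfl fun i _ => ?_
      rw [if_pos (h i), one_mul, ← Finset.prod_pow_eq_pow_sum, h i, Finset.prod_range]
    · rw [indicator_of_notMem (show ω ∉ {ω | ∀ i, X i ω = k i} from h)]
      obtain ⟨i, hi⟩ := not_forall.1 h
      exact (Finset.prod_eq_zero (Finset.mem_univ i) (by rw [if_neg hi, zero_mul])).symm
  · have h3 : ∀ i, (∫ ω, if X i ω = k i then 1 else 0 ∂P) * q ^ k i =
        ∫ ω, if X i ω = k i then q ^ k i else 0 ∂P := fun i => by
      rw [← integral_mul_const]
      simp only [ite_mul, one_mul, zero_mul]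
    simp only [h3]
    refine h2.symm.trans ?_
    congr 1
    funext ω
    by_cases h : ∀ i, X i ω = k i
    · rw [indicator_of_mem (show ω ∈ {ω | ∀ i, X i ω = k i} from h)]
      exact Finset.prod_congr rfl fun i _ => by rw [if_pos (h i), h i]
    · rw [indicator_of_notMem (show ω ∉ {ω | ∀ i, X i ω = k i} from h)]
      obtain ⟨i, hi⟩ := not_forall.1 h
      exact Finset.prod_eq_zero (Finset.mem_univ i) (by rw [if_neg hi])

theorem measurable_randomSum {Ω : Type*} [MeasurableSpace Ω] {n : ℕ}
    {X : Fin n → Ω → ℕ} {ε : Fin n → ℕ → Ω → ℕ} (hX : ∀ i, Measurable (X i))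
    (hε : ∀ i j, Measurable (ε i j)) :
    Measurable fun ω => ∑ i, ∑ j ∈ Finset.range (X i ω), ε i j ω := by
  refine Finset.measurable_fun_sum _ fun i _ => ?_
  have h : Measurable fun p : ℕ × Ω => ∑ j ∈ Finset.range p.1, ε i j p.2 :=
    measurable_from_prod_countable_right fun k =>
      Finset.measurable_fun_sum (Finset.range k) fun j _ => hε i j
  exact h.comp ((hX i).prodMk measurable_id)

theorem pgf_randomSum {Ω : Type*} [MeasurableSpace Ω] {P : Measure Ω} [IsProbabilityMeasure P]
    {n : ℕ} {X : Fin n → Ω → ℕ} {ε : Fin n → ℕ → Ω → ℕ} (hX : ∀ i, Measurable (X i))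
    (hε : ∀ i j, Measurable (ε i j))
    (hind : iIndepFun (Sum.elim X (fun k : Fin n × ℕ => ε k.1 k.2)) P) {z q : ℝ}
    (hz : z ∈ Icc (0 : ℝ) 1) (hqI : q ∈ Icc (0 : ℝ) 1) (hq : ∀ i j, pgf (ε i j) P z = q) :
    pgf (fun ω => ∑ i, ∑ j ∈ Finset.range (X i ω), ε i j ω) P z = ∏ i, pgf (X i) P q := by
  have hmeas : ∀ k : Fin n → ℕ, MeasurableSet {ω | ∀ i, X i ω = k i} := fun k => by
    rw [Set.ofPred_forall]
    exact MeasurableSet.iInter fun i => hX i (measurableSet_singleton (k i))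
  have hdisj : Pairwise (Function.onFun Disjoint fun k : Fin n → ℕ => {ω | ∀ i, X i ω = k i}) := by
    intro k l hkl
    refine Set.disjoint_left.2 fun ω hk hl => hkl (funext fun i => (hk i).symm.trans (hl i))
  have huniv : ⋃ k : Fin n → ℕ, {ω | ∀ i, X i ω = k i} = univ :=
    eq_univ_of_forall fun ω => mem_iUnion.2 ⟨fun i => X i ω, fun i => rfl⟩
  have hi1 := integrable_pow_of_mem_Icc (P := P) (measurable_randomSum hX hε) hz
  have hi2 : Integrable (fun ω => ∏ i, q ^ X i ω) P := by
    have := integrable_pow_of_mem_Icc (P := P)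
      (Finset.measurable_fun_sum Finset.univ fun i _ => hX i) hqI
    simpa only [Finset.prod_pow_eq_pow_sum] using this
  have s1 := hasSum_integral_iUnion hmeas hdisj hi1.integrableOn
  have s2 := hasSum_integral_iUnion hmeas hdisj hi2.integrableOn
  -- The events `X = k` form a countable partition, and both integrands have the same integral on
  -- each of them.
  simp only [setIntegral_pow_randomSum hX hε hind hq] at s1
  have h := s1.unique s2
  rw [huniv, setIntegral_univ, setIntegral_univ] at h
  rw [pgf, h]
  exact (hind.precomp Sum.inl_injective).integral_fun_prod_comp (𝕜 := ℝ) (f := fun _ x => q ^ x)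
    (fun i => (hX i).aemeasurable) (fun i => (measurable_of_countable _).aestronglyMeasurable)

theorem IdentDistrib.pgf_eq {Ω Ω' : Type*} [MeasurableSpace Ω] [MeasurableSpace Ω']
    {P : Measure Ω} {P' : Measure Ω'} {X : Ω → ℕ} {Y : Ω' → ℕ} (h : IdentDistrib X Y P P')
    (z : ℝ) : pgf X P z = pgf Y P' z :=
  (h.comp (measurable_of_countable fun k : ℕ => z ^ k)).integral_eq

theorem pgf_id_map {Ω : Type*} [MeasurableSpace Ω] {P : Measure Ω} {X : Ω → ℕ}
    (hX : Measurable X) (z : ℝ) : pgf id (P.map X) z = pgf X P z :=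
  integral_map hX.aemeasurable (measurable_of_countable _).aestronglyMeasurable

/-- Otherwise divide the difference by `z ^ N`, where `N` is the first index at which the
coefficients differ, and let `z` tend to `0` from the right. -/
theorem eq_of_forall_hasSum_pow {a c : ℕ → ℝ} {f : ℝ → ℝ}
    (ha : ∀ z ∈ Ico (0 : ℝ) 1, HasSum (fun k => a k * z ^ k) (f z))
    (hc : ∀ z ∈ Ico (0 : ℝ) 1, HasSum (fun k => c k * z ^ k) (f z)) : a = c := by
  by_contra hne
  have hex : ∃ k, a k - c k ≠ 0 := by
    by_contra! h
    exact hne (funext fun k => sub_eq_zero.1 (h k))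
  classical
  set N := Nat.find hex with hN
  have hlt : ∀ k < N, a k - c k = 0 := fun k hk => not_not.1 (Nat.find_min hex hk)
  have hd : ∀ z ∈ Ico (0 : ℝ) 1, HasSum (fun k => (a k - c k) * z ^ k) 0 := fun z hz => by
    simpa only [sub_mul, sub_self] using (ha z hz).sub (hc z hz)
  have hshift : ∀ z ∈ Ioo (0 : ℝ) 1, HasSum (fun k => (a (k + N) - c (k + N)) * z ^ k) 0 := by
    intro z hz
    have h := (hasSum_nat_add_iff' N).2 (hd z (Ioo_subset_Ico_self hz))
    rw [Finset.sum_eq_zero fun k hk => by rw [hlt k (Finset.mem_range.1 hk), zero_mul],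
      sub_zero] at h
    have hz' : z ^ N ≠ 0 := pow_ne_zero _ hz.1.ne'
    have := h.mul_right (z ^ N)⁻¹
    rw [zero_mul] at this
    refine this.congr_fun fun k => ?_
    rw [pow_add]
    field_simp
  -- the shifted series is continuous at `0` from the right, with value its constant term
  have hs := (hshift 2⁻¹ ⟨by norm_num, by norm_num⟩).summable.norm
  have hlim : Filter.Tendsto (fun z : ℝ => ∑' k, (a (k + N) - c (k + N)) * z ^ k)
      (nhdsWithin 0 (Ioi 0)) (nhds (∑' k, (a (k + N) - c (k + N)) * (0 : ℝ) ^ k)) := by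
    refine tendsto_tsum_of_dominated_convergence hs (fun k => ?_) ?_
    · have : Continuous fun z : ℝ => (a (k + N) - c (k + N)) * z ^ k := by fun_prop
      exact (this.tendsto 0).mono_left nhdsWithin_le_nhds
    · filter_upwards [Ioo_mem_nhdsGT (show (0 : ℝ) < 2⁻¹ by norm_num)] with z hz k
      rw [norm_mul, norm_mul, norm_pow, norm_pow, Real.norm_of_nonneg hz.1.le,
        Real.norm_of_nonneg (by norm_num : (0 : ℝ) ≤ 2⁻¹)]
      have h0 := hz.1.le
      have h1 := hz.2.le
      gcongr
  have hzero : Filter.Tendsto (fun z : ℝ => ∑' k, (a (k + N) - c (k + N)) * z ^ k)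
      (nhdsWithin 0 (Ioi 0)) (nhds 0) := by
    refine tendsto_const_nhds.congr' ?_
    filter_upwards [Ioo_mem_nhdsGT (zero_lt_one' ℝ)] with z hz
    exact (hshift z hz).tsum_eq.symm
  have h := tendsto_nhds_unique hlim hzero
  rw [tsum_eq_single 0 fun k hk => by rw [zero_pow hk, mul_zero]] at h
  simp only [zero_add, pow_zero, mul_one] at h
  exact Nat.find_spec hex h

/-- A probability law on `ℕ` is determined by its generating function. -/
theorem measure_eq_of_pgf_eq {μ ν : Measure ℕ} [IsProbabilityMeasure μ] [IsProbabilityMeasure ν]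
    (h : ∀ z ∈ Icc (0 : ℝ) 1, pgf id μ z = pgf id ν z) : μ = ν := by
  have hc := eq_of_forall_hasSum_pow
    (fun z hz => pgf_id_eq_tsum μ (Ico_subset_Icc_self hz))
    (fun z hz => (h z (Ico_subset_Icc_self hz)) ▸ pgf_id_eq_tsum ν (Ico_subset_Icc_self hz))
  refine Measure.ext_of_singleton fun k => ?_
  exact (ENNReal.toReal_eq_toReal_iff' (measure_ne_top _ _) (measure_ne_top _ _)).1
    (congrFun hc k)

theorem identDistrib_of_pgf_eq {Ω Ω' : Type*} [MeasurableSpace Ω] [MeasurableSpace Ω']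
    {P : Measure Ω} {P' : Measure Ω'} [IsProbabilityMeasure P] [IsProbabilityMeasure P']
    {X : Ω → ℕ} {Y : Ω' → ℕ} (hX : Measurable X) (hY : Measurable Y)
    (h : ∀ z ∈ Icc (0 : ℝ) 1, pgf X P z = pgf Y P' z) : IdentDistrib X Y P P' := by
  have := Measure.isProbabilityMeasure_map (μ := P) hX.aemeasurable
  have := Measure.isProbabilityMeasure_map (μ := P') hY.aemeasurable
  exact ⟨hX.aemeasurable, hY.aemeasurable, measure_eq_of_pgf_eq fun z hz => by
    rw [pgf_id_map hX, pgf_id_map hY, h z hz]⟩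

/-- Existence of all the variables that enter the definition of discrete stability. -/
theorem exists_iIndepFun_copies (μ ν : Measure ℕ) [IsProbabilityMeasure μ]
    [IsProbabilityMeasure ν] (n : ℕ) :
    ∃ (Ω : Type) (_ : MeasurableSpace Ω) (P : Measure Ω) (X : Fin n → Ω → ℕ)
      (ε : Fin n → ℕ → Ω → ℕ), IsProbabilityMeasure P ∧ (∀ i, Measurable (X i)) ∧
      (∀ i j, Measurable (ε i j)) ∧ (∀ i, P.map (X i) = μ) ∧ (∀ i j, P.map (ε i j) = ν) ∧
      iIndepFun (Sum.elim X (fun k : Fin n × ℕ => ε k.1 k.2)) P := by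
  let ρ : Fin n ⊕ (Fin n × ℕ) → Measure ℕ := Sum.elim (fun _ => μ) (fun _ => ν)
  have hρ : ∀ i, IsProbabilityMeasure (ρ i) := by
    rintro (i | p)
    · exact inferInstanceAs (IsProbabilityMeasure μ)
    · exact inferInstanceAs (IsProbabilityMeasure ν)
  refine ⟨Fin n ⊕ (Fin n × ℕ) → ℕ, inferInstance, Measure.infinitePi ρ,
    fun i ω => ω (Sum.inl i), fun i j ω => ω (Sum.inr (i, j)), inferInstance,
    fun i => by fun_prop, fun i j => by fun_prop,
    fun i => Measure.infinitePi_map_eval ρ (Sum.inl i),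
    fun i j => Measure.infinitePi_map_eval ρ (Sum.inr (i, j)), ?_⟩
  have h := iIndepFun_infinitePi (P := ρ) (X := fun _ x => x) fun _ => measurable_id
  convert h using 1
  funext i
  rcases i with i | p <;> rfl

/-- Stability equation for the generating function of a discrete stable variable. -/
theorem IsPositiveDiscreteStable.pgf_eq {Ω : Type*} [MeasurableSpace Ω] {Q : ℝ → ℝ → ℝ}
    {X : Ω → ℕ} {P : Measure Ω} (h : IsPositiveDiscreteStable Q X P)
    (hQ : ∀ p ∈ Ioo (0 : ℝ) 1, MapsTo (Q p) (Icc 0 1) (Icc 0 1)) {n : ℕ} (hn : 2 ≤ n) :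
    ∃ p ∈ Ioo (0 : ℝ) 1, (∀ z ∈ Icc (0 : ℝ) 1, pgf X P z = pgf X P (Q p z) ^ n) ∧
      IsPGF (Q p) := by
  obtain ⟨p, hp, Ω', _, P', X', ε, hP', hX', hε, hXd, hεd, hind, hS⟩ := h n hn
  refine ⟨p, hp, fun z hz => ?_, ?_⟩
  · rw [IdentDistrib.pgf_eq hS, pgf_randomSum hX' hε hind hz (hQ p hp hz)
      fun i j => hεd i j z hz]
    simp [fun i => IdentDistrib.pgf_eq (hXd i) (Q p z)]
  · have i0 : Fin n := ⟨0, by omega⟩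
    exact ⟨P'.map (ε i0 0), Measure.isProbabilityMeasure_map (hε i0 0).aemeasurable,
      fun z hz => by rw [pgf_id_map (hε i0 0), hεd i0 0 z hz]⟩

theorem isPositiveDiscreteStable_of_pgf_eq {Ω : Type*} [MeasurableSpace Ω] {Q : ℝ → ℝ → ℝ}
    {X : Ω → ℕ} {P : Measure Ω} [IsProbabilityMeasure P] (hX : Measurable X)
    (hQ : ∀ p ∈ Ioo (0 : ℝ) 1, MapsTo (Q p) (Icc 0 1) (Icc 0 1))
    (h : ∀ n : ℕ, 2 ≤ n → ∃ p ∈ Ioo (0 : ℝ) 1,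
      (∀ z ∈ Icc (0 : ℝ) 1, pgf X P z = pgf X P (Q p z) ^ n) ∧ IsPGF (Q p)) :
    IsPositiveDiscreteStable Q X P := by
  intro n hn
  obtain ⟨p, hp, heq, ν, hν, hνQ⟩ := h n hn
  have := Measure.isProbabilityMeasure_map (μ := P) hX.aemeasurable
  obtain ⟨Ω', mΩ', P', X', ε, hP', hX', hε, hXd, hεd, hind⟩ :=
    exists_iIndepFun_copies (P.map X) ν n
  have hid : ∀ i, IdentDistrib (X' i) X P' P := fun i =>
    ⟨(hX' i).aemeasurable, hX.aemeasurable, hXd i⟩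
  have hεQ : ∀ i j, ∀ z ∈ Icc (0 : ℝ) 1, pgf (ε i j) P' z = Q p z := fun i j z hz => by
    rw [← pgf_id_map (hε i j), hεd, hνQ z hz]
  refine ⟨p, hp, Ω', mΩ', P', X', ε, hP', hX', hε, hid, hεQ, hind,
    identDistrib_of_pgf_eq hX (measurable_randomSum hX' hε) fun z hz => ?_⟩
  rw [pgf_randomSum hX' hε hind hz (hQ p hp hz) fun i j => hεQ i j z hz, heq z hz]
  simp [fun i => IdentDistrib.pgf_eq (hid i) (Q p z)]

/-! ### Monotonicity and convexity of the generating function -/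

theorem pgf_nonneg {Ω : Type*} [MeasurableSpace Ω] {P : Measure Ω} {X : Ω → ℕ} {z : ℝ}
    (hz : 0 ≤ z) : 0 ≤ pgf X P z :=
  integral_nonneg fun _ => pow_nonneg hz _

section

variable {Ω : Type*} [MeasurableSpace Ω] {P : Measure Ω} [IsProbabilityMeasure P] {X : Ω → ℕ}

theorem pgf_strictMonoOn (hX : Measurable X) (hX0 : ¬ ∀ᵐ ω ∂P, X ω = 0) :
    StrictMonoOn (pgf X P) (Icc 0 1) := by
  intro z hz w hw hzw
  refine (integral_mono (integrable_pow_of_mem_Icc hX hz) (integrable_pow_of_mem_Icc hX hw)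
    fun ω => pow_le_pow_left₀ hz.1 hzw.le _).lt_of_ne fun heq => hX0 ?_
  have h0 : ∫ ω, (w ^ X ω - z ^ X ω) ∂P = 0 := by
    rw [integral_sub (integrable_pow_of_mem_Icc hX hw) (integrable_pow_of_mem_Icc hX hz)]
    exact sub_eq_zero.2 heq.symm
  rw [integral_eq_zero_iff_of_nonneg
    (fun ω => sub_nonneg.2 (pow_le_pow_left₀ hz.1 hzw.le _))
    ((integrable_pow_of_mem_Icc hX hw).sub (integrable_pow_of_mem_Icc hX hz))] at h0
  filter_upwards [h0] with ω hω
  by_contra hne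
  have := pow_lt_pow_left₀ hzw hz.1 hne
  simp only [Pi.zero_apply] at hω
  linarith

theorem pgf_one (X : Ω → ℕ) : pgf X P 1 = 1 := by simp [pgf]

/-- The chord bound from convexity, obtained by integrating `z ^ k ≤ z + (1 - z) * 0 ^ k`, with `0 ^
0 = 1`. -/
theorem one_sub_mul_le_one_sub_pgf (hX : Measurable X) {z : ℝ} (hz : z ∈ Icc (0 : ℝ) 1) :
    (1 - z) * (1 - pgf X P 0) ≤ 1 - pgf X P z := by
  have h0 := integrable_pow_of_mem_Icc (P := P) hX (z := 0) ⟨le_rfl, zero_le_one⟩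
  have hle : pgf X P z ≤ ∫ ω, (z + (1 - z) * 0 ^ X ω) ∂P := by
    refine integral_mono (integrable_pow_of_mem_Icc hX hz)
      ((integrable_const _).add (h0.const_mul _)) fun ω => ?_
    rcases Nat.eq_zero_or_pos (X ω) with h | h
    · simp [h]
    · simpa [zero_pow h.ne'] using pow_le_of_le_one hz.1 hz.2 h.ne'
  rw [integral_add (integrable_const _) (h0.const_mul _), integral_const_mul] at hle
  simp only [integral_const, probReal_univ, smul_eq_mul, one_mul] at hle
  have : ∫ ω, (0 : ℝ) ^ X ω ∂P = pgf X P 0 := rfl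
  rw [this] at hle
  linarith

end

/-! ### The characterization -/

theorem hasChebyshevStablePGF_iff {Ω : Type*} [MeasurableSpace Ω] {P : Measure Ω} {X : Ω → ℕ}
    {b : ℝ} {m : ℕ} {γ lam : ℝ} (hb : b ∈ Ioo (-1 : ℝ) 1) :
    HasChebyshevStablePGF γ lam b m X P ↔
      ∀ z ∈ Icc (0 : ℝ) 1, pgf X P z = Real.exp (-lam * (2 * halfAngle b m z) ^ γ) := by
  refine forall₂_congr fun z hz => ?_
  rw [← arccos_chebyshevR hb m hz, chebyshevR]

theorem rpow_neg_div_mem_Ioo {γ : ℝ} (hγ : 0 < γ) {n : ℕ} (hn : 2 ≤ n) :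
    (n : ℝ) ^ (-1 / γ) ∈ Ioo (0 : ℝ) 1 := by
  have hn1 : (1 : ℝ) < n := by exact_mod_cast hn
  exact ⟨by positivity,
    Real.rpow_lt_one_of_one_lt_of_neg hn1 (div_neg_of_neg_of_pos (by norm_num) hγ)⟩

theorem halfAngle_sq_le {b : ℝ} {m : ℕ} (hb : b ∈ Ioo (-1 : ℝ) 1) {z : ℝ} (hz : z ∈ Icc (0 : ℝ) 1) :
    halfAngle b m z ^ 2 ≤ chebyshevKappa b * m * (1 - z) := by
  have hk := chebyshevKappa_pos hb
  have h1 := (one_sub_pow_mem_Icc hz m).1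
  have h2 : halfAngle b m z ^ 2 ≤ chebyshevKappa b * (1 - z ^ m) := by
    rw [← Real.sq_sqrt (mul_nonneg hk.le h1)]
    exact pow_le_pow_left₀ (halfAngle_mem_Icc hb m hz).1 (arctan_le_self (Real.sqrt_nonneg _)) 2
  have h3 : 1 - z ^ m ≤ m * (1 - z) := by
    have := one_add_mul_le_pow (a := z - 1) (by linarith [hz.1]) m
    rw [add_sub_cancel] at this
    linarith
  calc _ ≤ chebyshevKappa b * (1 - z ^ m) := h2
    _ ≤ chebyshevKappa b * (m * (1 - z)) := by gcongr
    _ = _ := by ring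

section

variable {Ω : Type*} [MeasurableSpace Ω] {P : Measure Ω} {X : Ω → ℕ} {b : ℝ} {m : ℕ}

theorem HasChebyshevStablePGF.pgf_eq {γ lam : ℝ} (hb : b ∈ Ioo (-1 : ℝ) 1) (hm : 1 ≤ m)
    (hγ : 0 < γ) (h : HasChebyshevStablePGF γ lam b m X P) {n : ℕ} (hn : 2 ≤ n) {z : ℝ}
    (hz : z ∈ Icc (0 : ℝ) 1) :
    pgf X P z = pgf X P (chebyshevQ b m ((n : ℝ) ^ (-1 / γ)) z) ^ n := by
  rw [hasChebyshevStablePGF_iff hb] at h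
  have hp := rpow_neg_div_mem_Ioo hγ hn
  have hp' := Ioo_subset_Icc_self hp
  have hx := (halfAngle_mem_Icc hb m hz).1
  have hn0 : (0 : ℝ) < n := by positivity
  rw [h z hz, h _ (chebyshevQ_mem_Icc hb m hp' hz), halfAngle_chebyshevQ hb hm hp' hz,
    ← Real.exp_nat_mul, mul_left_comm 2, Real.mul_rpow hp.1.le (by positivity),
    ← Real.rpow_mul hn0.le, div_mul_cancel₀ _ hγ.ne', Real.rpow_neg_one]
  congr 1
  field_simp

/-- The parameter in the stability equation is determined by `n`. -/
theorem HasChebyshevStablePGF.eq_rpow {γ lam p : ℝ} (hb : b ∈ Ioo (-1 : ℝ) 1) (hm : 1 ≤ m)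
    (hγ : 0 < γ) (hlam : 0 < lam) (h : HasChebyshevStablePGF γ lam b m X P) {n : ℕ} (hn : 2 ≤ n)
    (hp : p ∈ Ioo (0 : ℝ) 1)
    (heq : ∀ z ∈ Icc (0 : ℝ) 1, pgf X P z = pgf X P (chebyshevQ b m p z) ^ n) :
    p = (n : ℝ) ^ (-1 / γ) := by
  rw [hasChebyshevStablePGF_iff hb] at h
  have hp' := Ioo_subset_Icc_self hp
  -- The equation at `z = 0` suffices: the angle there is positive, so comparing exponents gives `n
  -- * p ^ γ = 1`.
  have hz : (0 : ℝ) ∈ Icc (0 : ℝ) 1 := ⟨le_rfl, zero_le_one⟩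
  have hx : 0 < 2 * halfAngle b m 0 := by
    have := maxHalfAngle_pos hb
    rw [halfAngle, zero_pow (by omega), sub_zero, mul_one]
    simpa [maxHalfAngle] using this
  have hn0 : (0 : ℝ) < n := by positivity
  have h0 := heq 0 hz
  rw [h 0 hz, h _ (chebyshevQ_mem_Icc hb m hp' hz), halfAngle_chebyshevQ hb hm hp' hz,
    ← Real.exp_nat_mul, mul_left_comm 2, Real.mul_rpow hp.1.le hx.le] at h0
  have h1 := Real.exp_injective h0
  have hxγ : 0 < (2 * halfAngle b m 0) ^ γ := by positivity
  have h2 : p ^ γ = (n : ℝ)⁻¹ := by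
    have h3 : lam * (2 * halfAngle b m 0) ^ γ * (n * p ^ γ) = lam * (2 * halfAngle b m 0) ^ γ := by
      linarith
    exact eq_inv_of_mul_eq_one_right ((mul_eq_left₀ (by positivity)).1 h3)
  rw [← Real.rpow_neg_one] at h2
  rw [← Real.rpow_rpow_inv hp.1.le hγ.ne', h2, ← Real.rpow_mul hn0.le, div_eq_mul_inv]

variable [IsProbabilityMeasure P]

/-- Needed before taking logarithms. Shrinking the angle moves `0` to `Q p 0 > 0`, where the
strictly increasing generating function is positive. -/
theorem pgf_zero_pos_of_eq_pow (hX : Measurable X) (hX0 : ¬ ∀ᵐ ω ∂P, X ω = 0)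
    (hb : b ∈ Ioo (-1 : ℝ) 1) (hm : 1 ≤ m) {p : ℝ} (hp : p ∈ Ioo (0 : ℝ) 1) {n : ℕ}
    (heq : ∀ z ∈ Icc (0 : ℝ) 1, pgf X P z = pgf X P (chebyshevQ b m p z) ^ n) :
    0 < pgf X P 0 := by
  have hz : (0 : ℝ) ∈ Icc (0 : ℝ) 1 := ⟨le_rfl, zero_le_one⟩
  have hp' := Ioo_subset_Icc_self hp
  have hx := halfAngle_mem_Icc hb m hz
  have hx0 : 0 < halfAngle b m 0 := by
    have := maxHalfAngle_pos hb
    rw [halfAngle, zero_pow (by omega), sub_zero, mul_one]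
    simpa [maxHalfAngle] using this
  have hlt : 0 < chebyshevQ b m p 0 := by
    have := ofHalfAngle_strictAntiOn hb hm (mul_mem_Icc_zero hp' hx) hx
      (mul_lt_of_lt_one_left hx0 hp.2)
    rwa [ofHalfAngle_halfAngle hb hm hz, ← chebyshevQ_eq hb m hp' hz] at this
  rw [heq 0 hz]
  exact pow_pos ((pgf_nonneg le_rfl).trans_lt
    (pgf_strictMonoOn hX hX0 hz (chebyshevQ_mem_Icc hb m hp' hz) hlt)) n

theorem exists_hasChebyshevStablePGF (hX : Measurable X) (hX0 : ¬ ∀ᵐ ω ∂P, X ω = 0)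
    (hb : b ∈ Ioo (-1 : ℝ) 1) (hm : 1 ≤ m)
    (h : ∀ n : ℕ, 2 ≤ n → ∃ p ∈ Ioo (0 : ℝ) 1, ∀ z ∈ Icc (0 : ℝ) 1,
      pgf X P z = pgf X P (chebyshevQ b m p z) ^ n) :
    ∃ γ > (0 : ℝ), ∃ lam > (0 : ℝ), HasChebyshevStablePGF γ lam b m X P := by
  have h0 : (0 : ℝ) ∈ Icc (0 : ℝ) 1 := ⟨le_rfl, zero_le_one⟩
  have hmono := pgf_strictMonoOn hX hX0
  obtain ⟨p₂, hp₂, heq₂⟩ := h 2 le_rfl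
  have hP0 := pgf_zero_pos_of_eq_pow hX hX0 hb hm hp₂ heq₂
  have hpos : ∀ z ∈ Icc (0 : ℝ) 1, 0 < pgf X P z := fun z hz =>
    hP0.trans_le (hmono.monotoneOn h0 hz hz.1)
  obtain ⟨γ, hγ, lam, hlam, hg⟩ := eq_mul_rpow_of_functional_equation
    (g := fun x => -Real.log (pgf X P (ofHalfAngle b m x))) (maxHalfAngle_pos hb)
    (fun x hx y hy hxy => neg_lt_neg (Real.log_lt_log
      (hpos _ (ofHalfAngle_mem_Icc hb m hy))
      (hmono (ofHalfAngle_mem_Icc hb m hy) (ofHalfAngle_mem_Icc hb m hx)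
        (ofHalfAngle_strictAntiOn hb hm hx hy hxy))))
    (fun n hn => by
      obtain ⟨p, hp, heq⟩ := h n hn
      refine ⟨p, hp, fun x hx => ?_⟩
      have hz := ofHalfAngle_mem_Icc hb m hx
      rw [heq _ hz, chebyshevQ_eq hb m (Ioo_subset_Icc_self hp) hz,
        halfAngle_ofHalfAngle hb hm hx, Real.log_pow, mul_neg])
  -- The factor `2 ^ γ` accounts for the angle `arccos R` being twice the half angle.
  refine ⟨γ, hγ, lam / 2 ^ γ, by positivity, (hasChebyshevStablePGF_iff hb).2 fun z hz => ?_⟩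
  have hx := halfAngle_mem_Icc hb m hz
  have := hg _ hx
  rw [ofHalfAngle_halfAngle hb hm hz] at this
  rw [Real.mul_rpow zero_le_two hx.1, ← Real.exp_log (hpos z hz)]
  congr 1
  have h2 : (2 : ℝ) ^ γ ≠ 0 := by positivity
  field_simp
  linarith

/-- The exponent of a stable generating function is at most `2`. -/
theorem HasChebyshevStablePGF.exponent_le_two (hX : Measurable X)
    (hX0 : ¬ ∀ᵐ ω ∂P, X ω = 0) (hb : b ∈ Ioo (-1 : ℝ) 1) (hm : 1 ≤ m) {γ lam : ℝ}
    (hlam : 0 < lam) (h : HasChebyshevStablePGF γ lam b m X P) : γ ≤ 2 := by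
  by_contra! hγ
  rw [hasChebyshevStablePGF_iff hb] at h
  have hk := chebyshevKappa_pos hb
  have hm0 : (0 : ℝ) < m := by exact_mod_cast hm
  have hc : 0 < 1 - pgf X P 0 := by
    have := pgf_strictMonoOn hX hX0 (left_mem_Icc.2 zero_le_one) (right_mem_Icc.2 zero_le_one)
      zero_lt_one
    rw [pgf_one] at this
    linarith
  -- The lower bound of order `x ^ 2` and the upper bound of order `x ^ γ` for `1 - P` keep `x ^ (γ
  -- - 2)` above a positive constant, which is impossible as `x` tends to `0` when `γ > 2`.
  have key : ∀ x ∈ Ioc 0 (maxHalfAngle b),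
      (1 - pgf X P 0) / (chebyshevKappa b * m * (lam * 2 ^ γ)) ≤ x ^ (γ - 2) := by
    intro x hx
    have hx' := Ioc_subset_Icc_self hx
    have hz := ofHalfAngle_mem_Icc hb m hx'
    have h1 := one_sub_mul_le_one_sub_pgf (P := P) hX hz
    have h2 := halfAngle_sq_le (m := m) hb hz
    rw [h _ hz] at h1
    rw [halfAngle_ofHalfAngle hb hm hx'] at h1 h2
    have h3 := Real.add_one_le_exp (-lam * (2 * x) ^ γ)
    rw [Real.mul_rpow zero_le_two hx.1.le] at h1 h3
    have h4 : (1 - ofHalfAngle b m x) * (1 - pgf X P 0) ≤ lam * (2 ^ γ * x ^ γ) := by linarith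
    have h5 : x ^ γ = x ^ (γ - 2) * x ^ 2 := by
      rw [← Real.rpow_natCast, ← Real.rpow_add hx.1]
      norm_num
    have hx2 : 0 < x ^ 2 := pow_pos hx.1 2
    rw [div_le_iff₀ (by positivity)]
    refine le_of_mul_le_mul_right ?_ hx2
    calc (1 - pgf X P 0) * x ^ 2
        ≤ (1 - pgf X P 0) * (chebyshevKappa b * m * (1 - ofHalfAngle b m x)) := by gcongr
      _ = chebyshevKappa b * m * ((1 - ofHalfAngle b m x) * (1 - pgf X P 0)) := by ring
      _ ≤ chebyshevKappa b * m * (lam * (2 ^ γ * x ^ γ)) := by gcongr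
      _ = _ := by rw [h5]; ring
  have hlim : Filter.Tendsto (fun x : ℝ => x ^ (γ - 2)) (nhdsWithin 0 (Ioi 0)) (nhds 0) := by
    have := (Real.continuousAt_rpow_const 0 (γ - 2) (Or.inr (by linarith))).tendsto
    rw [Real.zero_rpow (by linarith)] at this
    exact this.mono_left nhdsWithin_le_nhds
  have hle := ge_of_tendsto hlim (Filter.eventually_of_mem
    (Ioc_mem_nhdsGT (maxHalfAngle_pos hb)) key)
  have : 0 < (1 - pgf X P 0) / (chebyshevKappa b * m * (lam * 2 ^ γ)) := by positivity
  linarith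

theorem pgf_eq_pow_iff (hX : Measurable X) (hX0 : ¬ ∀ᵐ ω ∂P, X ω = 0)
    (hb : b ∈ Ioo (-1 : ℝ) 1) (hm : 1 ≤ m) :
    (∀ n : ℕ, 2 ≤ n → ∃ p ∈ Ioo (0 : ℝ) 1, ∀ z ∈ Icc (0 : ℝ) 1,
        pgf X P z = pgf X P (chebyshevQ b m p z) ^ n) ↔
      ∃ γ ∈ Ioc (0 : ℝ) 2, ∃ lam > (0 : ℝ), HasChebyshevStablePGF γ lam b m X P := by
  constructor
  · intro h
    obtain ⟨γ, hγ, lam, hlam, hs⟩ := exists_hasChebyshevStablePGF hX hX0 hb hm h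
    exact ⟨γ, ⟨hγ, hs.exponent_le_two hX hX0 hb hm hlam⟩, lam, hlam, hs⟩
  · rintro ⟨γ, hγ, lam, -, hs⟩ n hn
    exact ⟨_, rpow_neg_div_mem_Ioo hγ.1 hn, fun z hz => hs.pgf_eq hb hm hγ.1 hn hz⟩

theorem isPositiveDiscreteStable_iff (hX : Measurable X) (hX0 : ¬ ∀ᵐ ω ∂P, X ω = 0)
    (hb : b ∈ Ioo (-1 : ℝ) 1) (hm : 1 ≤ m) :
    IsPositiveDiscreteStable (chebyshevQ b m) X P ↔
      ∃ γ ∈ Ioc (0 : ℝ) 2, ∃ lam > (0 : ℝ), HasChebyshevStablePGF γ lam b m X P ∧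
        ∀ n : ℕ, 2 ≤ n → IsPGF (chebyshevQ b m ((n : ℝ) ^ (-1 / γ))) := by
  have hQ : ∀ p ∈ Ioo (0 : ℝ) 1, MapsTo (chebyshevQ b m p) (Icc 0 1) (Icc 0 1) :=
    fun p hp z hz => chebyshevQ_mem_Icc hb m (Ioo_subset_Icc_self hp) hz
  constructor
  · intro h
    obtain ⟨γ, hγ, lam, hlam, hs⟩ := (pgf_eq_pow_iff hX hX0 hb hm).1 fun n hn =>
      let ⟨p, hp, heq, _⟩ := h.pgf_eq hQ hn
      ⟨p, hp, heq⟩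
    refine ⟨γ, hγ, lam, hlam, hs, fun n hn => ?_⟩
    obtain ⟨p, hp, heq, hpgf⟩ := h.pgf_eq hQ hn
    rwa [← hs.eq_rpow hb hm hγ.1 hlam hn hp heq]
  · rintro ⟨γ, hγ, lam, -, hs, hpgf⟩
    exact isPositiveDiscreteStable_of_pgf_eq hX hQ fun n hn =>
      ⟨_, rpow_neg_div_mem_Ioo hγ.1 hn, fun z hz => hs.pgf_eq hb hm hγ.1 hn hz, hpgf n hn⟩

end

theorem mainTheorem7 {Ω : Type*} [MeasurableSpace Ω] (P : Measure Ω) [IsProbabilityMeasure P]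
    (X : Ω → ℕ) (hX : Measurable X) (hX0 : ¬ ∀ᵐ ω ∂P, X ω = 0)
    (b : ℝ) (hb : b ∈ Ioo (-1 : ℝ) 1) (m : ℕ) (hm : 1 ≤ m) :
    -- the characterization for the lattice parameter `m = 1`
    (m = 1 →
      (IsPositiveDiscreteStable (chebyshevQ b m) X P ↔
        ∃ γ ∈ Ioc (0 : ℝ) 2, ∃ lam > (0 : ℝ), HasChebyshevStablePGF γ lam b m X P)) ∧
    -- the characterization for every `m`, the thinning variables being required to exist
    (IsPositiveDiscreteStable (chebyshevQ b m) X P ↔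
      ∃ γ ∈ Ioc (0 : ℝ) 2, ∃ lam > (0 : ℝ), HasChebyshevStablePGF γ lam b m X P ∧
        ∀ n : ℕ, 2 ≤ n → IsPGF (chebyshevQ b m ((n : ℝ) ^ (-1 / γ)))) ∧
    -- the characterization for every `m` through the stability equation of the
    -- probability generating function
    ((∀ n : ℕ, 2 ≤ n → ∃ p ∈ Ioo (0 : ℝ) 1, ∀ z ∈ Icc (0 : ℝ) 1,
        pgf X P z = pgf X P (chebyshevQ b m p z) ^ n) ↔
      ∃ γ ∈ Ioc (0 : ℝ) 2, ∃ lam > (0 : ℝ), HasChebyshevStablePGF γ lam b m X P) := by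
  refine ⟨?_, isPositiveDiscreteStable_iff hX hX0 hb hm, pgf_eq_pow_iff hX hX0 hb hm⟩
  rintro rfl
  rw [isPositiveDiscreteStable_iff hX hX0 hb hm]
  constructor
  · rintro ⟨γ, hγ, lam, hlam, hs, -⟩
    exact ⟨γ, hγ, lam, hlam, hs⟩
  · rintro ⟨γ, hγ, lam, hlam, hs⟩
    exact ⟨γ, hγ, lam, hlam, hs, fun n hn =>
      isPGF_chebyshevQ_one hb (rpow_neg_div_mem_Ioo hγ.1 hn)⟩
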